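/- Let $D\ge 1$, $Q\ge 0$ be integers, $0<\gamma\le 1$, $C\in\mathbb R$, $0<\epsilon<1$, $c_0>0$. Let $f:[0,1]^D\to(0,\infty)$ be continuous with $\int_{[0,1]^D} f\,dx=1$, let $\mu$ be the probability measure on $\mathbb R^D$ with Lebesgue density $f\mathbf 1_{[0,1]^D}$, and put $$f_*=\inf_{[0,1]^D} f,\qquad f^*=\sup_{[0,1]^D} f,\qquad \varpi(h)=\sup\{|f(x)-f(z)|:\ x,z\in[0,1]^D,\ |x-z|_\infty\le h\}.$$ Let $y:[0,1]^D\to\mathbb R$ be $(Q+\gamma,C)$-smooth, i.e. $Q$-times continuously differentiable, with all partial derivatives of order $Q$ being $\gamma$-Hölder continuous with constant $C$ with respect to the Euclidean norm. For integers $N,L\ge 1$ consider the following estimator. The basis functions $\eta_1,\dots,\eta_K$ are, in any fixed order, the functions $$x\mapsto \mathbf 1_{C_{\mathbf i}}(x)\,N^{D/2}\prod_{d=1}^D\sqrt{2j_d+1}\;\mathcal L_{j_d}\bigl(2(Nx_d-i_d)-1\bigr),\qquad C_{\mathbf i}=\prod_{d=1}^D\Bigl(\tfrac{i_d}{N},\tfrac{i_d+1}{N}\Bigr],$$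 with $\mathbf i\in\{0,\dots,N-1\}^D$ and $\mathbf j\in\mathbb N_0^D$, $\sum_d j_d\le Q$, where $\mathcal L_q$ is the Legendre polynomial of degree $q$ with $\mathcal L_q(1)=1$. Given i.i.d. samples $X^{(1)},\dots,X^{(L)}$ of law $\mu$ and $Y^{(l)}=y(X^{(l)})$, let $A=(\eta_k(X^{(l)}))_{l,k}$ and take a singular value decomposition $A^\top=\mathcal U\mathcal D\mathcal V$ ($\mathcal U,\mathcal V$ orthogonal) with singular values $s_1\ge\dots\ge s_K\ge 0$ (where $s_k=0$ for $k>L$). Put $\tau=(1-\epsilon)f_*/2$. If $s_K^2\ge L\tau$, let $\alpha_L=\mathcal U\mathcal D^\dagger\mathcal V\,(Y^{(1)},\dots,Y^{(L)})^\top$, where $\mathcal D^\dagger$ is the $K\times L$ matrix with $s_1^{-1},\dots,s_K^{-1}$ on the diagonal and zeros elsewhere; otherwise let $\alpha_L=0$. The estimate is $\hat y_L=\sum_{k}\alpha_{L,k}\eta_k$. Consider the conditions $$\text{(GC)}\quad Q=0\ \text{ or }\ 2\binom{D+Q}{D}e^{2Q}\,\varpi(1/N)\le f_*,$$ $$\text{(S)}\quad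 L\ \ge\ \frac{N^D\binom{D+Q}{D}e^{2Q}\bigl(36\frac{f^*}{f_*}+4\epsilon\bigr)+6\epsilon f^*}{3\epsilon^2f_*}\,\log\bigl(c_0N^{D+2(Q+\gamma)}\bigr).$$ (a) If $N,L$ satisfy (GC) and (S), then $$E\left[\int_{[0,1]^D}|y-\hat y_L|^2\,d\mu\right]\le\frac{1}{N^{2(Q+\gamma)}}\left(\Bigl(1+\frac{3f^*}{f_*(1-\epsilon)}\Bigr)\frac{D^{2Q+\gamma}}{(Q!)^2}\,C^2+\frac{2\binom{D+Q}{D}}{c_0}\int_{[0,1]^D}|y|^2\,d\mu\right),$$ and all integrals that occur are finite. (b) There are constants $c$ and $L_0$, depending only on $D,Q,\gamma,C,\epsilon,c_0,f,y$, such that for every $L\ge L_0$ there is a largest integer $N_L\ge1$ satisfying (S), this $N_L$ satisfies (GC), and the estimator with $N=N_L$ has root mean squared error $$\left(E\left[\int_{[0,1]^D}|y-\hat y_L|^2\,d\mu\right]\right)^{1/2}\le c\,L^{-(Q+\gamma)/D}(\log L)^{(Q+\gamma)/D}.$$ -/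

import Mathlib

open MeasureTheory ProbabilityTheory Set

universe u

namespace SVDRegression

noncomputable section

/-- The closed unit cube `[0,1]^D`. The ambient norm of `Fin D → ℝ` is the maximum norm. -/
def unitCube (D : ℕ) : Set (Fin D → ℝ) := Icc 0 1

/-- The measure on `ℝ^D` with Lebesgue density `f · 1_{[0,1]^D}`. -/
def cubeLaw {D : ℕ} (f : (Fin D → ℝ) → ℝ) : Measure (Fin D → ℝ) :=
  volume.withDensity fun x => ENNReal.ofReal ((unitCube D).indicator f x)

/-- `f_*`, the infimum of `f` over the unit cube. -/
def lowerBd {D : ℕ} (f : (Fin D → ℝ) → ℝ) : ℝ := sInf (f '' unitCube D)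

/-- `f^*`, the supremum of `f` over the unit cube. -/
def upperBd {D : ℕ} (f : (Fin D → ℝ) → ℝ) : ℝ := sSup (f '' unitCube D)

/-- The modulus of continuity of `f` on the unit cube with respect to the maximum norm. -/
def modulus {D : ℕ} (f : (Fin D → ℝ) → ℝ) (h : ℝ) : ℝ :=
  sSup {r : ℝ | ∃ x ∈ unitCube D, ∃ z ∈ unitCube D, ‖x - z‖ ≤ h ∧ r = |f x - f z|}

/-- The Legendre polynomial of degree `q`, normalized to take the value `1` at `1`. -/
def legendre (q : ℕ) (x : ℝ) : ℝ :=
  1 / 2 ^ q * ∑ r ∈ Finset.range (q / 2 + 1),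
    (-1) ^ r * ((2 * q - 2 * r).factorial : ℝ) /
      (r.factorial * (q - r).factorial * (q - 2 * r).factorial) * x ^ (q - 2 * r)

/-- The half-open grid cube `∏_d (i_d / N, (i_d + 1) / N]`. -/
def gridCube {D N : ℕ} (i : Fin D → Fin N) : Set (Fin D → ℝ) :=
  {x | ∀ d, ((i d : ℕ) : ℝ) / N < x d ∧ x d ≤ (((i d : ℕ) : ℝ) + 1) / N}

/-- Index set of the basis: a grid cube `i ∈ {0, …, N-1}^D` together with a multi-index `j` of
total degree at most `Q` (so that every `j_d` is at most `Q`). -/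
abbrev BasisIndex (D N Q : ℕ) : Type :=
  (Fin D → Fin N) × {j : Fin D → Fin (Q + 1) // ∑ d, (j d : ℕ) ≤ Q}

/-- The scaled tensor Legendre polynomial of multi-degree `j`, restricted to the grid cube `i`. -/
def basisFun {D N Q : ℕ} (b : BasisIndex D N Q) (x : Fin D → ℝ) : ℝ :=
  (gridCube b.1).indicator
    (fun x => (N : ℝ) ^ ((D : ℝ) / 2) * ∏ d, (√(2 * ((b.2.1 d : ℕ) : ℝ) + 1) *
      legendre (b.2.1 d : ℕ) (2 * (N * x d - ((b.1 d : ℕ) : ℝ)) - 1))) x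

/-- The `K × L` matrix with `s` on its diagonal and zeros elsewhere. -/
def rectDiag {K : ℕ} (L : ℕ) (s : Fin K → ℝ) : Matrix (Fin K) (Fin L) ℝ :=
  Matrix.of fun k l => if (k : ℕ) = (l : ℕ) then s k else 0

/-- `Aᵀ = U D V` is a singular value decomposition of `Aᵀ`, with `s_1 ≥ … ≥ s_K ≥ 0` on the
diagonal of the `K × L` matrix `D`; if `L < K`, the values `s_k`, `k > L`, for which the diagonal
has no room, are zero. -/
structure IsSVD {K L : ℕ} (A : Matrix (Fin L) (Fin K) ℝ) (U : Matrix (Fin K) (Fin K) ℝ)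
    (s : Fin K → ℝ) (V : Matrix (Fin L) (Fin L) ℝ) : Prop where
  orthogonal_left : U ∈ Matrix.orthogonalGroup (Fin K) ℝ
  orthogonal_right : V ∈ Matrix.orthogonalGroup (Fin L) ℝ
  antitone : Antitone s
  nonneg : ∀ k, 0 ≤ s k
  eq_zero : ∀ k : Fin K, L ≤ (k : ℕ) → s k = 0
  decomp : A.transpose = U * rectDiag L s * V

/-- `α` is a coefficient vector returned by least-squares regression with brute-force SVD
truncation at threshold `τ`, for the regression matrix `A` and the data `Y`: with some singular
value decomposition `Aᵀ = U D V`, it is `U D† V Y` if the smallest singular value (hence each of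
them) satisfies `s² ≥ L τ`, and zero otherwise. -/
def IsTruncatedCoeff {K L : ℕ} (A : Matrix (Fin L) (Fin K) ℝ) (Y : Fin L → ℝ) (τ : ℝ)
    (α : Fin K → ℝ) : Prop :=
  ∃ (U : Matrix (Fin K) (Fin K) ℝ) (s : Fin K → ℝ) (V : Matrix (Fin L) (Fin L) ℝ),
    IsSVD A U s V ∧
    ((∀ k, L * τ ≤ s k ^ 2) → α = (U * rectDiag L (fun k => (s k)⁻¹) * V).mulVec Y) ∧
    ((∃ k, s k ^ 2 < L * τ) → α = 0)

/-- Every matrix has a singular value decomposition. -/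
theorem exists_isSVD {K L : ℕ} (A : Matrix (Fin L) (Fin K) ℝ) :
    ∃ (U : Matrix (Fin K) (Fin K) ℝ) (s : Fin K → ℝ) (V : Matrix (Fin L) (Fin L) ℝ),
      IsSVD A U s V := by
  set T : EuclideanSpace ℝ (Fin K) →ₗ[ℝ] EuclideanSpace ℝ (Fin L) := Matrix.toEuclideanLin A
    with hT
  have hK : Module.finrank ℝ (EuclideanSpace ℝ (Fin K)) = K := by simp
  set u := T.isSymmetric_adjoint_comp_self.eigenvectorBasis hK with hu
  have hin : ∀ i j : Fin K, inner ℝ (T (u i)) (T (u j)) =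
      if i = j then T.singularValues j ^ 2 else 0 := by
    intro i j
    have h1 := T.isSymmetric_adjoint_comp_self.apply_eigenvectorBasis hK j
    rw [← hu] at h1
    rw [← LinearMap.adjoint_inner_right, ← LinearMap.comp_apply, h1, inner_smul_right,
      u.inner_eq_ite, T.sq_singularValues_fin hK]
    split_ifs <;> simp
  have hzero : ∀ i : Fin K, T.singularValues i = 0 → T (u i) = 0 := by
    intro i hi
    have := hin i i
    rw [if_pos rfl, hi] at this
    simpa using this
  have hbig : ∀ n : ℕ, L ≤ n → T.singularValues n = 0 := by
    intro n hn
    rw [T.singularValues_eq_zero_iff_le_finrank_range]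
    exact (Submodule.finrank_le _).trans (by simpa using hn)
  -- the normalized images, extended to an orthonormal basis
  set w : Fin L → EuclideanSpace ℝ (Fin L) := fun l =>
    if h : (l : ℕ) < K then (T.singularValues l)⁻¹ • T (u ⟨l, h⟩) else 0 with hw
  set S : Set (Fin L) := {l | T.singularValues l ≠ 0} with hS
  have hlt : ∀ l ∈ S, (l : ℕ) < K := by
    intro l hl
    by_contra h
    exact hl (T.singularValues_of_finrank_le (by simpa using h))
  have hon : Orthonormal ℝ (S.domRestrict w) := by
    rw [orthonormal_iff_ite]
    rintro ⟨a, ha⟩ ⟨b, hb⟩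
    have ha' : T.singularValues a ≠ 0 := ha
    simp only [Set.domRestrict_apply, hw, hlt a ha, hlt b hb, dite_true]
    rw [inner_smul_left, inner_smul_right, hin]
    by_cases hab : a = b
    · subst hab
      simp
      field_simp
    · have : ¬ (a : ℕ) = b := fun h => hab (Fin.ext h)
      simp [hab, this]
  obtain ⟨v, hv⟩ := hon.exists_orthonormalBasis_extension_of_card_eq (by simp)
  have key : ∀ (i : Fin K) (l : Fin L),
      T (u i) l = ∑ m : Fin L, if (i : ℕ) = (m : ℕ) then T.singularValues i * v m l else 0 := by
    intro i l
    by_cases hi : T.singularValues i = 0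
    · rw [hzero i hi]
      simp [hi]
    · have hiL : (i : ℕ) < L := by
        by_contra h
        exact hi (hbig _ (not_lt.1 h))
      rw [Finset.sum_eq_single (⟨i, hiL⟩ : Fin L)]
      · have hmem : (⟨i, hiL⟩ : Fin L) ∈ S := hi
        rw [hv _ hmem]
        simp [hw, hi]
      · intro m _ hm
        rw [if_neg]
        intro h
        exact hm (Fin.ext h.symm)
      · simp
  set U : Matrix (Fin K) (Fin K) ℝ := Matrix.of fun k i => u i k with hU
  set V : Matrix (Fin L) (Fin L) ℝ := Matrix.of fun m l => v m l with hV
  have hUU : U.transpose * U = 1 := by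
    ext i j
    have := u.inner_eq_ite i j
    simp only [PiLp.inner_apply, RCLike.inner_apply, conj_trivial] at this
    simp only [Matrix.mul_apply, Matrix.transpose_apply, hU, Matrix.of_apply, Matrix.one_apply]
    rw [← this]
    exact Finset.sum_congr rfl fun _ _ => mul_comm _ _
  have hVV : V * V.transpose = 1 := by
    ext i j
    have := v.inner_eq_ite i j
    simp only [PiLp.inner_apply, RCLike.inner_apply, conj_trivial] at this
    simp only [Matrix.mul_apply, Matrix.transpose_apply, hV, Matrix.of_apply, Matrix.one_apply]
    rw [← this]
    exact Finset.sum_congr rfl fun _ _ => mul_comm _ _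
  have hUA : U.transpose * A.transpose = rectDiag L (fun k : Fin K => T.singularValues k) * V := by
    ext i l
    have := key i l
    simp only [hT, Matrix.toLpLin_apply, Matrix.mulVec, dotProduct] at this
    simp only [Matrix.mul_apply, Matrix.transpose_apply, hU, hV, Matrix.of_apply, rectDiag,
      ite_mul, zero_mul]
    rw [← this]
    exact Finset.sum_congr rfl fun _ _ => mul_comm _ _
  refine ⟨U, fun k => T.singularValues k, V, ?_, ?_, ?_, ?_, ?_, ?_⟩
  · rw [Matrix.mem_orthogonalGroup_iff']
    exact hUU
  · rw [Matrix.mem_orthogonalGroup_iff]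
    exact hVV
  · exact fun a b hab => T.singularValues_antitone hab
  · exact fun k => T.singularValues_nonneg k
  · exact fun k hk => hbig k hk
  · rw [Matrix.mul_assoc, ← hUA, ← Matrix.mul_assoc, mul_eq_one_comm.1 hUU, Matrix.one_mul]

/-- The truncated regression always has an output. -/
theorem exists_isTruncatedCoeff {K L : ℕ} (A : Matrix (Fin L) (Fin K) ℝ) (Y : Fin L → ℝ)
    (τ : ℝ) : ∃ α, IsTruncatedCoeff A Y τ α := by
  obtain ⟨U, s, V, h⟩ := exists_isSVD A
  by_cases hs : ∀ k, L * τ ≤ s k ^ 2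
  · exact ⟨_, U, s, V, h, fun _ => rfl, fun ⟨k, hk⟩ => absurd (hs k) (not_le.2 hk)⟩
  · exact ⟨0, U, s, V, h, fun h' => absurd h' hs, fun _ => rfl⟩

/-- The estimate `x ↦ ∑_k α_k η_k(x)`, where the basis functions are ordered by `e`. -/
def estimate {D N Q K : ℕ} (e : Fin K ≃ BasisIndex D N Q) (α : Fin K → ℝ) (x : Fin D → ℝ) : ℝ :=
  ∑ k, α k * basisFun (e k) x

/-- `X^{(1)}, …, X^{(L)}` is an i.i.d. sample from the law with density `f · 1_{[0,1]^D}`, and `α`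
is the (random) coefficient vector returned by the truncated regression with the basis ordered by
`e`, the threshold `τ` and the data `Y^{(l)} = y(X^{(l)})`. -/
structure IsRegressionRun {Ω : Type*} [MeasurableSpace Ω] (P : Measure Ω) {D N Q K L : ℕ}
    (f y : (Fin D → ℝ) → ℝ) (τ : ℝ) (e : Fin K ≃ BasisIndex D N Q)
    (X : Fin L → Ω → Fin D → ℝ) (α : Ω → Fin K → ℝ) : Prop where
  indep : iIndepFun X P
  law : ∀ l, HasLaw (X l) (cubeLaw f) P
  coeff : ∀ ω, IsTruncatedCoeff (Matrix.of fun l k => basisFun (e k) (X l ω))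
    (fun l => y (X l ω)) τ (α ω)

/-- The squared error `∫_{[0,1]^D} |y - ŷ|² dμ` of the estimate with coefficients `α`. -/
def sqError {D N Q K : ℕ} (f y : (Fin D → ℝ) → ℝ) (e : Fin K ≃ BasisIndex D N Q)
    (α : Fin K → ℝ) : ℝ :=
  ∫ x in unitCube D, |y x - estimate e α x| ^ 2 ∂(cubeLaw f)

/-- `y` is `(Q + γ, C)`-smooth on the unit cube: it is `Q`-times continuously differentiable there,
and all partial derivatives of order `Q` are `γ`-Hölder continuous with constant `C` with respect
to the Euclidean norm. -/
def IsHolderSmooth {D : ℕ} (Q : ℕ) (γ C : ℝ) (y : (Fin D → ℝ) → ℝ) : Prop :=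
  ContDiffOn ℝ Q y (unitCube D) ∧
  ∀ d : Fin Q → Fin D, ∀ x ∈ unitCube D, ∀ z ∈ unitCube D,
    |iteratedFDerivWithin ℝ Q y (unitCube D) x (fun m => Pi.single (d m) 1) -
      iteratedFDerivWithin ℝ Q y (unitCube D) z (fun m => Pi.single (d m) 1)| ≤
      C * ‖WithLp.toLp 2 (x - z)‖ ^ γ

/-- The condition linking the degree `Q` and the grid width `1 / N` to the modulus of continuity of
the density. It is stated without division, so that it holds if the modulus vanishes. -/
def GridCondition {D : ℕ} (Q N : ℕ) (f : (Fin D → ℝ) → ℝ) : Prop :=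
  Q = 0 ∨ 2 * ((D + Q).choose D : ℝ) * Real.exp (2 * Q) * modulus f (1 / N) ≤ lowerBd f

/-- The lower bound imposed on the number of samples. -/
def sampleBound {D : ℕ} (Q N : ℕ) (γ ε c₀ : ℝ) (f : (Fin D → ℝ) → ℝ) : ℝ :=
  ((N : ℝ) ^ D * (D + Q).choose D * Real.exp (2 * Q) * (36 * (upperBd f / lowerBd f) + 4 * ε) +
      6 * ε * upperBd f) / (3 * ε ^ 2 * lowerBd f) *
    Real.log (c₀ * (N : ℝ) ^ ((D : ℝ) + 2 * (Q + γ)))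

end

end SVDRegression

open SVDRegression

/-!
The mean squared error is split according to whether the coefficients are truncated.

If they are not, the coefficients `α` solve the normal equations, whose matrix is the Gram matrix
`∑_l η(X_l) η(X_l)ᵀ`, bounded below by `L τ`. Let `β` be the coefficients of the `L²(μ)`-projection
of `y` and `r` the residual of the projection. By stability of the normal equations
(`sub_dotProduct_self_le`), `‖α - β‖² ≤ (L τ)⁻¹ ∑_l r(X_l)²`, and the residual is orthogonal to the
span of the basis, so that the squared error is at most `∫ r² dμ + f^* (L τ)⁻¹ ∑_l r(X_l)²`. Its
expectation is `(1 + f^* / τ) ∫ r² dμ`, where `1 + f^* / τ = 1 + 2 f^* / (f_* (1 - ε))`. The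
integral of `r²` is at most the squared error of any other approximation from the span, for instance
of the piecewise Taylor polynomial (`exists_approx`), which belongs to the span because the Legendre
polynomials of degree at most `q` span all polynomials of degree at most `q`.

If they are, the error is `∫ y² dμ`, and the probability of truncation is estimated by the matrix
Chernoff bound (`integral_trace_exp_neg_gram_le`): with `R = N^D binom(D+Q, D) e^{2Q} ≥ |η|²`, an
eigenvalue of the Gram matrix below `L τ` forces `tr exp (- R⁻¹ ∑_l η(X_l) η(X_l)ᵀ)` to be at least
`exp (- L τ / R)`, while its expectation is at most `K exp (- L f_* / (2 R))`, as the law of the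
sample has density at least `f_*` on the cube and the basis is orthonormal for the Lebesgue measure.
Hence the probability is at most `K exp (- L ε f_* / (2 R))`, and the lower bound for `L` makes the
minimum of this and one at most `binom(D+Q, D) / (c₀ N^{2(Q+γ)})`. The bound for `|η|²` needs that
the Legendre polynomials are bounded by one on `[-1,1]`, which follows from their differential
equation. The Chernoff bound is proved by induction over the sample, the Golden–Thompson inequality
(`trace_exp_add_le`) splitting off one sample point at a time. That inequality is derived from the
Lie–Trotter formula and `tr (XY)^p ≤ tr X^p Y^p` for `p` a power of two, a consequence of Hölder's
inequality for Schatten norms.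

For the rate, the lower bound for `L` tends to infinity with `N`, so there is a largest `N = N_L`
that satisfies it; as `N_L + 1` does not, `L` is at most of order `N_L^D log L`. The grid condition
holds for large `N` by uniform continuity of the density.
-/

/-! ### The Golden–Thompson inequality -/

namespace SVDRegression

section GoldenThompson

open Matrix Filter Topology

variable {n : Type*} [Fintype n]

theorem trace_transpose_mul_self_nonneg (A : Matrix n n ℝ) : 0 ≤ (Aᵀ * A).trace := by
  simp only [trace, diag_apply, mul_apply, transpose_apply]
  exact Finset.sum_nonneg fun i _ => Finset.sum_nonneg fun j _ => mul_self_nonneg _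

/-- The Cauchy–Schwarz inequality for the Hilbert–Schmidt inner product. -/
theorem trace_mul_sq_le (A B : Matrix n n ℝ) :
    (A * B).trace ^ 2 ≤ (Aᵀ * A).trace * (Bᵀ * B).trace := by
  have h1 : (A * B).trace = ∑ p : n × n, A p.1 p.2 * B p.2 p.1 := by
    simp [trace, mul_apply, Fintype.sum_prod_type]
  have h2 : (Aᵀ * A).trace = ∑ p : n × n, A p.1 p.2 ^ 2 := by
    rw [trace_mul_comm]
    simp [trace, mul_apply, Fintype.sum_prod_type, sq]
  have h3 : (Bᵀ * B).trace = ∑ p : n × n, B p.2 p.1 ^ 2 := by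
    simp [trace, mul_apply, Fintype.sum_prod_type, sq]
  rw [h1, h2, h3]
  exact Finset.sum_mul_sq_le_sq_mul_sq _ _ _

variable [DecidableEq n]

theorem trace_mul_pow_comm (A B : Matrix n n ℝ) (k : ℕ) :
    ((A * B) ^ k).trace = ((B * A) ^ k).trace := by
  cases k with
  | zero => simp
  | succ k =>
    have : ∀ k : ℕ, (A * B) ^ k * A = A * (B * A) ^ k := by
      intro k
      induction k with
      | zero => simp
      | succ k ih => rw [pow_succ', pow_succ', mul_assoc, ih]; simp only [mul_assoc]
    rw [pow_succ, ← mul_assoc, this, mul_assoc, trace_mul_comm, mul_assoc, ← pow_succ]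

theorem isSymm_transpose_mul_self_pow (A : Matrix n n ℝ) (k : ℕ) :
    ((Aᵀ * A) ^ k)ᵀ = (Aᵀ * A) ^ k := by
  rw [transpose_pow, transpose_mul, transpose_transpose]

theorem trace_transpose_mul_self_pow_nonneg (A : Matrix n n ℝ) (k : ℕ) :
    0 ≤ ((Aᵀ * A) ^ 2 ^ k).trace := by
  cases k with
  | zero => simpa using trace_transpose_mul_self_nonneg A
  | succ k =>
    rw [pow_succ, pow_mul, sq]
    have := trace_transpose_mul_self_nonneg ((Aᵀ * A) ^ 2 ^ k)
    rwa [isSymm_transpose_mul_self_pow] at this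

/-- Hölder's inequality `‖AB‖_p ≤ ‖A‖_{2p} ‖B‖_{2p}` for the Schatten norms with exponents
`p = 2^{j+1}`, `j < k`, implies `|tr W^p| ≤ ‖W‖_p^p` for `p = 2^{k+1}`. -/
theorem abs_trace_pow_le_of_schatten_holder (k : ℕ)
    (h : ∀ j < k, ∀ A B : Matrix n n ℝ, (((A * B)ᵀ * (A * B)) ^ 2 ^ j).trace ^ 2 ≤
      ((Aᵀ * A) ^ 2 ^ (j + 1)).trace * ((Bᵀ * B) ^ 2 ^ (j + 1)).trace)
    (W : Matrix n n ℝ) : |(W ^ 2 ^ (k + 1)).trace| ≤ ((Wᵀ * W) ^ 2 ^ k).trace := by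
  have key : ∀ j ≤ k, |(W ^ 2 ^ (k + 1)).trace| ≤
      (((W ^ 2 ^ (k - j))ᵀ * W ^ 2 ^ (k - j)) ^ 2 ^ j).trace := by
    intro j
    induction j with
    | zero =>
      intro _
      refine abs_le_of_sq_le_sq ?_ (trace_transpose_mul_self_pow_nonneg _ _)
      rw [show 2 ^ (k + 1) = 2 ^ k * 2 from pow_succ 2 k, pow_mul, sq (W ^ 2 ^ k)]
      simpa [sq, -transpose_pow] using trace_mul_sq_le (W ^ 2 ^ k) (W ^ 2 ^ k)
    | succ j ih =>
      intro hj
      refine (ih (by omega)).trans ?_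
      have hs : W ^ 2 ^ (k - j) = W ^ 2 ^ (k - (j + 1)) * W ^ 2 ^ (k - (j + 1)) := by
        rw [← sq, ← pow_mul, ← pow_succ]
        congr 2
        omega
      have := h j (by omega) (W ^ 2 ^ (k - (j + 1))) (W ^ 2 ^ (k - (j + 1)))
      rw [← hs, ← sq] at this
      exact le_of_sq_le_sq this (trace_transpose_mul_self_pow_nonneg _ _)
  simpa using key k le_rfl

/-- Hölder's inequality `‖AB‖_p ≤ ‖A‖_{2p} ‖B‖_{2p}` for the Schatten norm with exponent
`p = 2^{k+1}`. -/
theorem schatten_holder (k : ℕ) (A B : Matrix n n ℝ) :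
    (((A * B)ᵀ * (A * B)) ^ 2 ^ k).trace ^ 2 ≤
      ((Aᵀ * A) ^ 2 ^ (k + 1)).trace * ((Bᵀ * B) ^ 2 ^ (k + 1)).trace := by
  induction k using Nat.strong_induction_on generalizing A B with
  | _ k ih =>
    have h0 : (((A * B)ᵀ * (A * B)) ^ 2 ^ k).trace =
        (((Aᵀ * A) * (B * Bᵀ)) ^ 2 ^ k).trace := by
      rw [transpose_mul, mul_assoc, trace_mul_pow_comm]
      simp only [mul_assoc]
    have hBB : ∀ m : ℕ, ((B * Bᵀ) ^ m).trace = ((Bᵀ * B) ^ m).trace := fun m =>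
      trace_mul_pow_comm _ _ _
    have hsA : (Aᵀ * A)ᵀ = Aᵀ * A := by simp
    have hsB : (B * Bᵀ)ᵀ = B * Bᵀ := by simp
    rw [h0, ← hBB]
    cases k with
    | zero =>
      have := trace_mul_sq_le (Aᵀ * A) (B * Bᵀ)
      rw [hsA, hsB] at this
      simpa [sq] using this
    | succ k =>
      have h1 := abs_trace_pow_le_of_schatten_holder k
        (fun j hj A B => ih j (by omega) A B) ((Aᵀ * A) * (B * Bᵀ))
      have h2 := ih k (by omega) (Aᵀ * A) (B * Bᵀ)
      rw [hsA, hsB, ← sq, ← sq, ← pow_mul, ← pow_mul, ← pow_succ'] at h2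
      exact (sq_le_sq' (by linarith [neg_le_of_abs_le h1]) (le_of_abs_le h1)).trans h2

/-- The inequality `|tr W^p| ≤ ‖W‖_p^p` for the Schatten norm with exponent `p = 2^{k+1}`. -/
theorem abs_trace_pow_le (k : ℕ) (W : Matrix n n ℝ) :
    |(W ^ 2 ^ (k + 1)).trace| ≤ ((Wᵀ * W) ^ 2 ^ k).trace :=
  abs_trace_pow_le_of_schatten_holder k (fun j _ => schatten_holder j) W

/-- The Golden–Thompson inequality before the passage to the limit. In the induction step,
`tr (XY)^{2p} ≤ tr ((XY)ᵀ XY)^p = tr (X² Y²)^p`. -/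
theorem trace_mul_pow_two_pow_le (k : ℕ) {X Y : Matrix n n ℝ} (hX : X.IsSymm) (hY : Y.IsSymm) :
    ((X * Y) ^ 2 ^ k).trace ≤ (X ^ 2 ^ k * Y ^ 2 ^ k).trace := by
  induction k generalizing X Y with
  | zero => simp
  | succ k ih =>
    refine (le_abs_self _).trans ((abs_trace_pow_le k _).trans ?_)
    have h : ((X * Y)ᵀ * (X * Y)) = Y * (X ^ 2 * Y) := by
      rw [transpose_mul, hX.eq, hY.eq, sq]
      simp only [mul_assoc]
    rw [h, trace_mul_pow_comm, mul_assoc, ← sq, show 2 ^ (k + 1) = 2 * 2 ^ k from pow_succ' 2 k,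
      pow_mul, pow_mul]
    exact ih (hX.pow 2) (hY.pow 2)

end GoldenThompson

section LieTrotter

open Filter Topology NormedSpace

variable {𝔸 : Type*} [NormedRing 𝔸]

theorem norm_pow_sub_pow_le [NormOneClass 𝔸] {c : ℝ} {X Y : 𝔸} (hX : ‖X‖ ≤ c) (hY : ‖Y‖ ≤ c)
    (m : ℕ) : ‖X ^ m - Y ^ m‖ ≤ m * c ^ (m - 1) * ‖X - Y‖ := by
  have hc : 0 ≤ c := (norm_nonneg X).trans hX
  induction m with
  | zero => simp
  | succ m ih =>
    have h : X ^ (m + 1) - Y ^ (m + 1) = X ^ m * (X - Y) + (X ^ m - Y ^ m) * Y := by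
      rw [pow_succ, pow_succ]; noncomm_ring
    have h1 : ‖X ^ m * (X - Y)‖ ≤ c ^ m * ‖X - Y‖ :=
      (norm_mul_le _ _).trans (mul_le_mul_of_nonneg_right
        ((norm_pow_le _ _).trans (pow_le_pow_left₀ (norm_nonneg _) hX m)) (norm_nonneg _))
    have h2 : ‖(X ^ m - Y ^ m) * Y‖ ≤ m * c ^ (m - 1) * ‖X - Y‖ * c :=
      (norm_mul_le _ _).trans (mul_le_mul ih hY (norm_nonneg _) (by positivity))
    have h3 : (m : ℝ) * c ^ (m - 1) * ‖X - Y‖ * c = m * c ^ m * ‖X - Y‖ := by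
      cases m with
      | zero => simp
      | succ m => simp [pow_succ]; ring
    rw [h]
    refine (norm_add_le _ _).trans ((add_le_add h1 (h2.trans_eq h3)).trans_eq ?_)
    push_cast
    ring

variable [NormedAlgebra ℝ 𝔸] [CompleteSpace 𝔸]

omit [CompleteSpace 𝔸] in
theorem norm_exp_le_exp_norm [NormOneClass 𝔸] (A : 𝔸) : ‖exp A‖ ≤ Real.exp ‖A‖ := by
  rw [exp_eq_tsum ℝ, Real.exp_eq_exp_ℝ, exp_eq_tsum ℝ]
  have hs := norm_expSeries_summable' (𝕂 := ℝ) A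
  have hs' := expSeries_summable' (𝕂 := ℝ) ‖A‖
  refine (norm_tsum_le_tsum_norm hs).trans (hs.tsum_le_tsum (fun k => ?_) hs')
  rw [norm_smul, smul_eq_mul, norm_inv, RCLike.norm_natCast]
  exact mul_le_mul_of_nonneg_left (norm_pow_le _ _) (by positivity)

/-- The Lie–Trotter product formula. -/
theorem tendsto_exp_mul_exp_pow [NormOneClass 𝔸] (A B : 𝔸) :
    Tendsto (fun m : ℕ => (exp ((m : ℝ)⁻¹ • A) * exp ((m : ℝ)⁻¹ • B)) ^ m) atTop
      (𝓝 (exp (A + B))) := by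
  have hd : HasDerivAt (fun t : ℝ => exp (t • A) * exp (t • B) - exp (t • (A + B)))
      (0 : 𝔸) 0 := by
    have h := ((hasDerivAt_exp_smul_const (𝕂 := ℝ) A 0).mul
      (hasDerivAt_exp_smul_const (𝕂 := ℝ) B 0)).sub
      (hasDerivAt_exp_smul_const (𝕂 := ℝ) (A + B) 0)
    exact h.congr_deriv (by simp)
  have ht : Tendsto (fun m : ℕ => ((m : ℝ)⁻¹ : ℝ)) atTop (𝓝[≠] 0) := by
    rw [tendsto_nhdsWithin_iff]
    refine ⟨tendsto_inv_atTop_zero.comp tendsto_natCast_atTop_atTop, ?_⟩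
    filter_upwards [eventually_gt_atTop 0] with m hm
    simp [hm.ne']
  have hlim := (hd.tendsto_slope_zero.comp ht).norm
  simp only [norm_zero, Function.comp_def, zero_add, zero_smul, exp_zero, mul_one, sub_self,
    sub_zero, inv_inv] at hlim
  set M := Real.exp (‖A‖ + ‖B‖) with hM
  rw [tendsto_iff_norm_sub_tendsto_zero]
  refine squeeze_zero' (Eventually.of_forall fun _ => norm_nonneg _) ?_
    (by simpa using hlim.const_mul M)
  filter_upwards [eventually_gt_atTop 0] with m hm
  have hm0 : (m : ℝ) ≠ 0 := by exact_mod_cast hm.ne'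
  set t : ℝ := (m : ℝ)⁻¹ with htdef
  have ht0 : 0 ≤ t := by positivity
  set c := Real.exp (t * (‖A‖ + ‖B‖)) with hc
  have hX : ‖exp (t • A) * exp (t • B)‖ ≤ c := by
    refine (norm_mul_le _ _).trans ((mul_le_mul (norm_exp_le_exp_norm _)
      (norm_exp_le_exp_norm _) (norm_nonneg _) (Real.exp_pos _).le).trans_eq ?_)
    rw [← Real.exp_add, norm_smul, norm_smul, Real.norm_of_nonneg ht0, hc, mul_add]
  have hY : ‖exp (t • (A + B))‖ ≤ c := by
    refine (norm_exp_le_exp_norm _).trans (Real.exp_le_exp.2 ?_)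
    rw [norm_smul, Real.norm_of_nonneg ht0]
    exact mul_le_mul_of_nonneg_left (norm_add_le _ _) ht0
  have hYm : exp (t • (A + B)) ^ m = exp (A + B) := by
    have : NormedAlgebra ℚ 𝔸 := NormedAlgebra.restrictScalars ℚ ℝ 𝔸
    rw [← exp_nsmul, ← Nat.cast_smul_eq_nsmul ℝ, smul_smul, htdef, mul_inv_cancel₀ hm0, one_smul]
  have hcM : c ^ (m - 1) ≤ M := by
    have h1 : c ^ m = M := by
      rw [hc, ← Real.exp_nat_mul, ← mul_assoc, htdef, mul_inv_cancel₀ hm0, one_mul]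
    rw [← h1]
    exact pow_le_pow_right₀ (Real.one_le_exp (by positivity)) (Nat.sub_le _ _)
  rw [← hYm]
  refine (norm_pow_sub_pow_le hX hY m).trans ?_
  rw [norm_smul, RCLike.norm_natCast]
  rw [← smul_add, mul_assoc, mul_left_comm]
  exact mul_le_mul_of_nonneg_right hcM (by positivity)

end LieTrotter

section GoldenThompson

open Matrix Filter Topology NormedSpace
open scoped Matrix.Norms.Operator

variable {n : Type*} [Fintype n] [DecidableEq n]

/-- The **Golden–Thompson inequality** for real symmetric matrices. -/
theorem trace_exp_add_le {A B : Matrix n n ℝ} (hA : A.IsSymm) (hB : B.IsSymm) :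
    (exp (A + B)).trace ≤ (exp A * exp B).trace := by
  rcases isEmpty_or_nonempty n with hn | hn
  · simp [trace]
  have hlim := (tendsto_exp_mul_exp_pow A B).comp
    (tendsto_pow_atTop_atTop_of_one_lt (r := 2) one_lt_two)
  have htr : Continuous (trace : Matrix n n ℝ → ℝ) := continuous_id.matrix_trace
  refine le_of_tendsto ((htr.tendsto _).comp hlim) (Eventually.of_forall fun k => ?_)
  simp only [Function.comp_apply]
  have h2 : ((2 ^ k : ℕ) : ℝ) ≠ 0 := by positivity
  have hp : ∀ C : Matrix n n ℝ, exp (((2 ^ k : ℕ) : ℝ)⁻¹ • C) ^ 2 ^ k = exp C := by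
    intro C
    rw [← Matrix.exp_nsmul, ← Nat.cast_smul_eq_nsmul ℝ, smul_smul, mul_inv_cancel₀ h2, one_smul]
  have := trace_mul_pow_two_pow_le k (hA.smul (((2 ^ k : ℕ) : ℝ)⁻¹)).exp
    (hB.smul (((2 ^ k : ℕ) : ℝ)⁻¹)).exp
  rwa [hp, hp] at this

end GoldenThompson

end SVDRegression

/-! ### The matrix Chernoff bound for random matrices of rank one -/

namespace SVDRegression

section MatrixChernoff

open Matrix NormedSpace
open scoped Matrix.Norms.Operator

variable {n : Type*} [Fintype n] [DecidableEq n]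

/-- The exponential of a multiple of a projection. -/
theorem exp_smul_of_isIdempotentElem {P : Matrix n n ℝ} (hP : IsIdempotentElem P) (a : ℝ) :
    exp (a • P) = 1 + (Real.exp a - 1) • P := by
  have h1 := exp_series_hasSum_exp' (𝕂 := ℝ) (a • P)
  have h2 := ((exp_series_hasSum_exp' (𝕂 := ℝ) a).smul_const P).add
    (hasSum_ite_eq 0 (1 - P))
  rw [← Real.exp_eq_exp_ℝ] at h2
  have h3 : (fun k : ℕ => ((k.factorial : ℝ)⁻¹) • (a • P) ^ k) =
      fun k : ℕ => (((k.factorial : ℝ)⁻¹) • a ^ k) • P + if k = 0 then 1 - P else 0 := by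
    funext k
    cases k with
    | zero => simp
    | succ k => simp [smul_pow, hP.pow_succ_eq, smul_smul]
  rw [h3] at h1
  refine (h1.unique h2).trans ?_
  rw [sub_smul, one_smul]
  abel

/-- The quadratic form of `exp H` is a sum of squares of linear forms, given by the rows of
`exp (H / 2)`. In this form it can be integrated with the bounds for `∫ (v ⬝ᵥ η)²`. -/
theorem dotProduct_exp_mulVec {H : Matrix n n ℝ} (hH : H.IsSymm) (w : n → ℝ) :
    w ⬝ᵥ (exp H *ᵥ w) = ∑ i, (exp ((2 : ℝ)⁻¹ • H) i ⬝ᵥ w) ^ 2 := by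
  have hF : (exp ((2 : ℝ)⁻¹ • H)).IsSymm := (hH.smul _).exp
  have hE : exp H = exp ((2 : ℝ)⁻¹ • H) * exp ((2 : ℝ)⁻¹ • H) := by
    rw [← Matrix.exp_add_of_commute _ _ (Commute.refl _), ← add_smul]
    norm_num
  rw [hE, ← mulVec_mulVec, dotProduct_mulVec, ← mulVec_transpose, hF.eq]
  simp [dotProduct, mulVec, sq]

theorem trace_exp_eq_sum {H : Matrix n n ℝ} (hH : H.IsSymm) :
    (exp H).trace = ∑ i, exp ((2 : ℝ)⁻¹ • H) i ⬝ᵥ exp ((2 : ℝ)⁻¹ • H) i := by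
  have hF : (exp ((2 : ℝ)⁻¹ • H)).IsSymm := (hH.smul _).exp
  have hE : exp H = exp ((2 : ℝ)⁻¹ • H) * (exp ((2 : ℝ)⁻¹ • H))ᵀ := by
    rw [hF.eq, ← Matrix.exp_add_of_commute _ _ (Commute.refl _), ← add_smul]
    norm_num
  rw [hE]
  simp [trace, mul_apply, dotProduct]

theorem trace_exp_nonneg {H : Matrix n n ℝ} (hH : H.IsSymm) : 0 ≤ (exp H).trace := by
  rw [trace_exp_eq_sum hH]
  exact Finset.sum_nonneg fun i _ => Finset.sum_nonneg fun j _ => mul_self_nonneg _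

omit [Fintype n] [DecidableEq n] in
theorem isSymm_vecMulVec_self (w : n → ℝ) : (vecMulVec w w).IsSymm := by
  ext i j
  simp [vecMulVec_apply, mul_comm]

/-- One step of the matrix Chernoff bound. By the Golden–Thompson inequality, subtracting
a matrix of rank one and norm at most one from the exponent splits off the factor
`exp (-R⁻¹ wwᵀ)`, which is at most `1 - (2R)⁻¹ wwᵀ`. -/
theorem trace_exp_sub_vecMulVec_le {H : Matrix n n ℝ} (hH : H.IsSymm) {w : n → ℝ} {R : ℝ}
    (hR : 0 < R) (hw : w ⬝ᵥ w ≤ R) :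
    (exp (H - R⁻¹ • vecMulVec w w)).trace ≤
      (exp H).trace - (2 * R)⁻¹ * (w ⬝ᵥ (exp H *ᵥ w)) := by
  have hq : 0 ≤ w ⬝ᵥ (exp H *ᵥ w) := by
    rw [dotProduct_exp_mulVec hH]
    positivity
  have hr0 : 0 ≤ w ⬝ᵥ w := Finset.sum_nonneg fun j _ => mul_self_nonneg _
  rcases hr0.eq_or_lt with hr | hr
  · have hw0 : w = 0 := dotProduct_self_eq_zero.1 hr.symm
    simp [hw0]
  set r := w ⬝ᵥ w with hrdef
  set P : Matrix n n ℝ := r⁻¹ • vecMulVec w w with hPdef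
  have hP : IsIdempotentElem P := by
    rw [IsIdempotentElem, hPdef, smul_mul_smul, vecMulVec_mul_vecMulVec, ← hrdef, vecMulVec_smul,
      smul_smul, mul_assoc, inv_mul_cancel₀ hr.ne', mul_one]
  have hZ : H - R⁻¹ • vecMulVec w w = H + (-(R⁻¹ * r)) • P := by
    rw [hPdef, smul_smul, neg_mul, mul_assoc, mul_inv_cancel₀ hr.ne', mul_one, neg_smul,
      sub_eq_add_neg]
  have hGT := trace_exp_add_le hH (((isSymm_vecMulVec_self w).smul r⁻¹).smul (-(R⁻¹ * r)))
  rw [← hPdef, ← hZ, exp_smul_of_isIdempotentElem hP, mul_add, mul_one, trace_add] at hGT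
  have htr : (exp H * ((Real.exp (-(R⁻¹ * r)) - 1) • P)).trace =
      -((1 - Real.exp (-(R⁻¹ * r))) * r⁻¹ * (w ⬝ᵥ (exp H *ᵥ w))) := by
    rw [hPdef, smul_smul, mul_smul_comm, trace_smul, mul_vecMulVec, trace_vecMulVec,
      dotProduct_comm, smul_eq_mul]
    ring
  have hx0 : 0 ≤ R⁻¹ * r := by positivity
  have hx1 : R⁻¹ * r ≤ 1 := by
    rw [inv_mul_le_iff₀ hR, mul_one]
    exact hw
  have hexp : Real.exp (-(R⁻¹ * r)) ≤ 1 - R⁻¹ * r / 2 := by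
    generalize R⁻¹ * r = x at hx0 hx1
    rw [Real.exp_neg]
    refine inv_le_of_inv_le₀ (by linarith) ?_
    refine le_trans ?_ (Real.add_one_le_exp x)
    rw [inv_le_iff_one_le_mul₀ (by linarith)]
    nlinarith
  have hcoef : (2 * R)⁻¹ ≤ (1 - Real.exp (-(R⁻¹ * r))) * r⁻¹ := by
    rw [← div_eq_mul_inv, le_div_iff₀ hr, mul_inv]
    linarith
  rw [htr] at hGT
  linarith [mul_le_mul_of_nonneg_right hcoef hq]

variable {𝓧 : Type*} [MeasurableSpace 𝓧] {μ : Measure 𝓧} [IsProbabilityMeasure μ]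
  {η : 𝓧 → n → ℝ} {R a : ℝ}

omit [DecidableEq n] in
theorem integrable_sq_dotProduct (hη : Measurable η) (hR : ∀ x, η x ⬝ᵥ η x ≤ R) (v : n → ℝ) :
    Integrable (fun x => (v ⬝ᵥ η x) ^ 2) μ := by
  refine Integrable.of_bound (C := (v ⬝ᵥ v) * R) ?_ (ae_of_all _ fun x => ?_)
  · refine Measurable.aestronglyMeasurable ?_
    simp only [dotProduct]
    fun_prop
  · rw [Real.norm_of_nonneg (sq_nonneg _)]
    have h := Finset.sum_mul_sq_le_sq_mul_sq Finset.univ v (η x)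
    have h1 : 0 ≤ v ⬝ᵥ v := Finset.sum_nonneg fun j _ => mul_self_nonneg _
    refine le_trans ?_ (mul_le_mul_of_nonneg_left (hR x) h1)
    simpa [dotProduct, sq] using h

theorem continuous_trace_exp : Continuous fun H : Matrix n n ℝ => (exp H).trace :=
  (exp_continuous (𝔸 := Matrix n n ℝ)).matrix_trace

theorem measurable_trace_exp_sub_sum (hη : Measurable η) (H : Matrix n n ℝ) (R : ℝ) (L : ℕ) :
    Measurable fun x : Fin L → 𝓧 =>
      (exp (H - R⁻¹ • ∑ l, vecMulVec (η (x l)) (η (x l)))).trace := by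
  have hc : Continuous fun w : Fin L → n → ℝ =>
      (exp (H - R⁻¹ • ∑ l, vecMulVec (w l) (w l))).trace := by
    refine continuous_trace_exp.comp ?_
    have hs : Continuous fun w : Fin L → n → ℝ => ∑ l, vecMulVec (w l) (w l) :=
      continuous_finsetSum _ fun l _ =>
        (continuous_apply l).matrix_vecMulVec (continuous_apply l)
    exact continuous_const.sub (hs.fun_const_smul _)
  exact hc.measurable.comp (measurable_pi_lambda _ fun l => hη.comp (measurable_pi_apply l))

/-- The expected effect of one sample point on the trace of the exponential. The lower bound for the
quadratic form of the Gram matrix is applied to each row of `exp (H / 2)`. -/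
theorem lintegral_trace_exp_sub_vecMulVec_le (hη : Measurable η) (hR0 : 0 < R)
    (hR : ∀ x, η x ⬝ᵥ η x ≤ R) (ha : ∀ v : n → ℝ, a * (v ⬝ᵥ v) ≤ ∫ x, (v ⬝ᵥ η x) ^ 2 ∂μ)
    {H : Matrix n n ℝ} (hH : H.IsSymm) :
    ∫⁻ x, ENNReal.ofReal (exp (H - R⁻¹ • vecMulVec (η x) (η x))).trace ∂μ ≤
      ENNReal.ofReal (Real.exp (-(a / (2 * R)))) * ENNReal.ofReal (exp H).trace := by
  let F : n → n → ℝ := (exp ((2 : ℝ)⁻¹ • H) : Matrix n n ℝ)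
  have hint : Integrable (fun x => ∑ i, (F i ⬝ᵥ η x) ^ 2) μ :=
    integrable_finsetSum _ fun i _ => integrable_sq_dotProduct hη hR _
  have hstep : ∀ x, (exp (H - R⁻¹ • vecMulVec (η x) (η x))).trace ≤
      (exp H).trace - (2 * R)⁻¹ * ∑ i, (F i ⬝ᵥ η x) ^ 2 := fun x =>
    (trace_exp_sub_vecMulVec_le hH hR0 (hR x)).trans_eq (by rw [dotProduct_exp_mulVec hH])
  have hnn : ∀ x, 0 ≤ (exp (H - R⁻¹ • vecMulVec (η x) (η x))).trace := fun x =>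
    trace_exp_nonneg (hH.sub ((isSymm_vecMulVec_self _).smul _))
  refine (lintegral_mono fun x => ENNReal.ofReal_le_ofReal (hstep x)).trans ?_
  have hI : Integrable (fun x => (exp H).trace - (2 * R)⁻¹ * ∑ i, (F i ⬝ᵥ η x) ^ 2) μ :=
    (integrable_const _).sub (hint.const_mul _)
  rw [← ofReal_integral_eq_lintegral_ofReal hI
    (ae_of_all _ fun x => (hnn x).trans (hstep x)), ← ENNReal.ofReal_mul (Real.exp_pos _).le]
  refine ENNReal.ofReal_le_ofReal ?_
  rw [integral_sub (integrable_const _) (hint.const_mul _), integral_const_mul,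
    integral_finsetSum _ fun i _ => integrable_sq_dotProduct hη hR _]
  have h1 : a * (exp H).trace ≤ ∑ i, ∫ x, (F i ⬝ᵥ η x) ^ 2 ∂μ := by
    rw [trace_exp_eq_sum hH, Finset.mul_sum]
    exact Finset.sum_le_sum fun i _ => ha (F i)
  have h2 := mul_le_mul_of_nonneg_left h1 (show 0 ≤ (2 * R)⁻¹ by positivity)
  have h3 := mul_le_mul_of_nonneg_right (Real.add_one_le_exp (-(a / (2 * R))))
    (trace_exp_nonneg hH)
  have h4 : (2 * R)⁻¹ * (a * (exp H).trace) = a / (2 * R) * (exp H).trace := by ring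
  simp only [integral_const, probReal_univ, one_smul]
  linarith

/-- The effect of `L` independent sample points, integrated out one after the other. The lower
integral spares the integrability of the inner integrals in the induction. -/
theorem lintegral_trace_exp_sub_sum_le (hη : Measurable η) (hR0 : 0 < R)
    (hR : ∀ x, η x ⬝ᵥ η x ≤ R) (ha : ∀ v : n → ℝ, a * (v ⬝ᵥ v) ≤ ∫ x, (v ⬝ᵥ η x) ^ 2 ∂μ)
    (L : ℕ) {H : Matrix n n ℝ} (hH : H.IsSymm) :
    ∫⁻ x : Fin L → 𝓧, ENNReal.ofReal
        (exp (H - R⁻¹ • ∑ l, vecMulVec (η (x l)) (η (x l)))).trace ∂Measure.pi (fun _ => μ) ≤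
      ENNReal.ofReal (Real.exp (-(a / (2 * R)))) ^ L * ENNReal.ofReal (exp H).trace := by
  induction L generalizing H with
  | zero => simp
  | succ L ih =>
    have hmp := (measurePreserving_piFinSuccAbove (fun _ : Fin (L + 1) => μ) 0).symm
    rw [← hmp.lintegral_comp (measurable_trace_exp_sub_sum hη H R (L + 1)).ennreal_ofReal,
      lintegral_prod]
    · have hrw : ∀ (x : 𝓧) (xs : Fin L → 𝓧),
          H - R⁻¹ • ∑ l, vecMulVec
            (η ((MeasurableEquiv.piFinSuccAbove (fun _ => 𝓧) 0).symm (x, xs) l))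
            (η ((MeasurableEquiv.piFinSuccAbove (fun _ => 𝓧) 0).symm (x, xs) l)) =
          (H - R⁻¹ • vecMulVec (η x) (η x)) -
            R⁻¹ • ∑ l, vecMulVec (η (xs l)) (η (xs l)) := by
        intro x xs
        rw [Fin.sum_univ_succ, smul_add, sub_sub]
        simp [MeasurableEquiv.piFinSuccAbove, Fin.insertNthEquiv]
      simp only [hrw]
      refine (lintegral_mono fun x =>
        ih (hH.sub ((isSymm_vecMulVec_self (η x)).smul R⁻¹))).trans ?_
      rw [lintegral_const_mul' _ _ (by finiteness), pow_succ, mul_assoc]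
      gcongr
      exact lintegral_trace_exp_sub_vecMulVec_le hη hR0 hR ha hH
    · exact ((measurable_trace_exp_sub_sum hη H R (L + 1)).ennreal_ofReal.comp
        hmp.measurable).aemeasurable

variable {Ω : Type*} [MeasurableSpace Ω] {P : Measure Ω} {L : ℕ} {X : Fin L → Ω → 𝓧}

/-- The matrix Chernoff bound, as a bound on the expected trace of the exponential of the scaled
empirical Gram matrix of an i.i.d. sample. -/
theorem lintegral_trace_exp_neg_gram_le (hη : Measurable η) (hR0 : 0 < R)
    (hR : ∀ x, η x ⬝ᵥ η x ≤ R) (ha : ∀ v : n → ℝ, a * (v ⬝ᵥ v) ≤ ∫ x, (v ⬝ᵥ η x) ^ 2 ∂μ)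
    (hX : iIndepFun X P) (hlaw : ∀ l, HasLaw (X l) μ P) :
    ∫⁻ ω, ENNReal.ofReal
        (exp (-(R⁻¹ • ∑ l, vecMulVec (η (X l ω)) (η (X l ω))))).trace ∂P ≤
      ENNReal.ofReal (Fintype.card n * Real.exp (-(L * a / (2 * R)))) := by
  have hl := hX.hasLaw_pi hlaw
  have h := lintegral_trace_exp_sub_sum_le hη hR0 hR ha L (H := 0) isSymm_zero
  rw [← hl.map_eq, lintegral_map'
    (measurable_trace_exp_sub_sum hη 0 R L).ennreal_ofReal.aemeasurable hl.aemeasurable] at h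
  simp only [zero_sub, exp_zero, trace_one] at h
  refine h.trans_eq ?_
  rw [← ENNReal.ofReal_pow (Real.exp_pos _).le, ← ENNReal.ofReal_mul (by positivity),
    ← Real.exp_nat_mul, mul_comm]
  congr 3
  ring

theorem aemeasurable_trace_exp_neg_gram (hη : Measurable η) (R : ℝ)
    (hX : ∀ l, AEMeasurable (X l) P) :
    AEMeasurable (fun ω =>
      (exp (-(R⁻¹ • ∑ l, vecMulVec (η (X l ω)) (η (X l ω))))).trace) P := by
  have h := (measurable_trace_exp_sub_sum hη 0 R L).comp_aemeasurable (aemeasurable_pi_lambda _ hX)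
  simpa [Function.comp_def] using h

omit [Fintype n] [DecidableEq n] in
theorem isSymm_neg_gram (w : Fin L → n → ℝ) (R : ℝ) :
    (-(R⁻¹ • ∑ l, vecMulVec (w l) (w l))).IsSymm := by
  refine IsSymm.neg (IsSymm.smul ?_ _)
  rw [IsSymm, transpose_sum]
  exact Finset.sum_congr rfl fun l _ => isSymm_vecMulVec_self _

/-- The matrix Chernoff bound `lintegral_trace_exp_neg_gram_le` in terms of the Bochner integral. -/
theorem integral_trace_exp_neg_gram_le (hη : Measurable η) (hR0 : 0 < R)
    (hR : ∀ x, η x ⬝ᵥ η x ≤ R) (ha : ∀ v : n → ℝ, a * (v ⬝ᵥ v) ≤ ∫ x, (v ⬝ᵥ η x) ^ 2 ∂μ)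
    (hX : iIndepFun X P) (hlaw : ∀ l, HasLaw (X l) μ P) :
    Integrable (fun ω =>
        (exp (-(R⁻¹ • ∑ l, vecMulVec (η (X l ω)) (η (X l ω))))).trace) P ∧
      ∫ ω, (exp (-(R⁻¹ • ∑ l, vecMulVec (η (X l ω)) (η (X l ω))))).trace ∂P ≤
        Fintype.card n * Real.exp (-(L * a / (2 * R))) := by
  have hm := aemeasurable_trace_exp_neg_gram hη R fun l => (hlaw l).aemeasurable
  have hnn : ∀ ω, 0 ≤ (exp (-(R⁻¹ • ∑ l, vecMulVec (η (X l ω)) (η (X l ω))))).trace :=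
    fun ω => trace_exp_nonneg (isSymm_neg_gram _ _)
  have h := lintegral_trace_exp_neg_gram_le hη hR0 hR ha hX hlaw
  have hi : Integrable (fun ω =>
      (exp (-(R⁻¹ • ∑ l, vecMulVec (η (X l ω)) (η (X l ω))))).trace) P :=
    lintegral_ofReal_ne_top_iff_integrable hm.aestronglyMeasurable (ae_of_all _ hnn) |>.1
      (h.trans_lt ENNReal.ofReal_lt_top).ne
  refine ⟨hi, ?_⟩
  rw [← ofReal_integral_eq_lintegral_ofReal hi (ae_of_all _ hnn)] at h
  exact (ENNReal.ofReal_le_ofReal_iff (by positivity)).1 h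

end MatrixChernoff

end SVDRegression

/-! ### Truncated least squares through the normal equations -/

namespace SVDRegression

section NormalEquations

open Matrix NormedSpace
open scoped Matrix.Norms.Operator

variable {K L : ℕ} {A : Matrix (Fin L) (Fin K) ℝ} {U : Matrix (Fin K) (Fin K) ℝ}
  {s : Fin K → ℝ} {V : Matrix (Fin L) (Fin L) ℝ}

theorem diagonal_mul_rectDiag (t s : Fin K → ℝ) :
    diagonal t * rectDiag L s = rectDiag L (fun k => t k * s k) := by
  ext k l
  simp [rectDiag, diagonal_mul]

namespace IsSVD

variable (h : IsSVD A U s V)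
include h

theorem rectDiag_mul_transpose :
    rectDiag L s * (rectDiag L s)ᵀ = diagonal fun k => s k ^ 2 := by
  ext k k'
  simp only [mul_apply, rectDiag, transpose_apply, of_apply, diagonal_apply]
  by_cases hk : (k : ℕ) < L
  · rw [Finset.sum_eq_single (⟨k, hk⟩ : Fin L)]
    · by_cases hkk : k = k'
      · subst hkk
        simp [sq]
      · have : (k' : ℕ) ≠ k := fun e => hkk (Fin.ext e.symm)
        simp [hkk, this]
    · intro l _ hl
      have : (k : ℕ) ≠ l := fun e => hl (Fin.ext e.symm)
      simp [this]
    · simp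
  · have h0 := h.eq_zero k (not_lt.1 hk)
    simp [h0]

theorem transpose_mul_self : Aᵀ * A = U * diagonal (fun k => s k ^ 2) * Uᵀ := by
  have hA : A = (U * rectDiag L s * V)ᵀ := by rw [← h.decomp, transpose_transpose]
  have hV : V * Vᵀ = 1 := (mem_orthogonalGroup_iff _ _).1 h.orthogonal_right
  rw [h.decomp, hA, transpose_mul, transpose_mul, ← h.rectDiag_mul_transpose]
  calc U * rectDiag L s * V * (Vᵀ * ((rectDiag L s)ᵀ * Uᵀ))
      = U * rectDiag L s * (V * Vᵀ) * ((rectDiag L s)ᵀ * Uᵀ) := by simp only [Matrix.mul_assoc]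
    _ = _ := by rw [hV, Matrix.mul_one]; simp only [Matrix.mul_assoc]

theorem transpose_left_mul : Uᵀ * U = 1 :=
  (mem_orthogonalGroup_iff' _ _).1 h.orthogonal_left

theorem dotProduct_mulVec_eq_sum (v : Fin K → ℝ) :
    (A *ᵥ v) ⬝ᵥ (A *ᵥ v) = ∑ k, s k ^ 2 * (Uᵀ *ᵥ v) k ^ 2 := by
  rw [dotProduct_mulVec, vecMul_mulVec, ← dotProduct_mulVec, h.transpose_mul_self,
    ← mulVec_mulVec, ← mulVec_mulVec, dotProduct_mulVec, ← mulVec_transpose]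
  simp only [dotProduct, mulVec_diagonal]
  exact Finset.sum_congr rfl fun k _ => by ring

theorem dotProduct_self_eq_sum (v : Fin K → ℝ) : v ⬝ᵥ v = ∑ k, (Uᵀ *ᵥ v) k ^ 2 := by
  have hU : U * Uᵀ = 1 := (mem_orthogonalGroup_iff _ _).1 h.orthogonal_left
  calc v ⬝ᵥ v = v ⬝ᵥ ((U * Uᵀ) *ᵥ v) := by rw [hU, one_mulVec]
    _ = (Uᵀ *ᵥ v) ⬝ᵥ (Uᵀ *ᵥ v) := by
      rw [← mulVec_mulVec, dotProduct_mulVec, ← mulVec_transpose]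
    _ = _ := by simp [dotProduct, sq]

theorem trace_exp_neg_gram (R : ℝ) :
    (exp (-(R⁻¹ • (Aᵀ * A)))).trace = ∑ k, Real.exp (-(R⁻¹ * s k ^ 2)) := by
  have hUi : U⁻¹ = Uᵀ := inv_eq_left_inv h.transpose_left_mul
  have hU : IsUnit U := (isUnit_iff_isUnit_det U).2
    (isUnit_det_of_left_inverse h.transpose_left_mul)
  have hG : -(R⁻¹ • (Aᵀ * A)) = U * diagonal (fun k => -(R⁻¹ * s k ^ 2)) * U⁻¹ := by
    have hd : (diagonal fun k => -(R⁻¹ * s k ^ 2)) =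
        (-R⁻¹) • (diagonal fun k => s k ^ 2 : Matrix (Fin K) (Fin K) ℝ) := by
      rw [← diagonal_smul]
      congr 1
      funext k
      simp
    rw [hd, hUi, h.transpose_mul_self, Matrix.mul_smul, Matrix.smul_mul, neg_smul]
  rw [hG, Matrix.exp_conj _ _ hU, trace_mul_comm, hUi, ← Matrix.mul_assoc, h.transpose_left_mul,
    Matrix.one_mul, Matrix.exp_diagonal, trace_diagonal]
  refine Finset.sum_congr rfl fun k _ => ?_
  rw [Pi.coe_exp, ← Real.exp_eq_exp_ℝ]

end IsSVD

/-- The output of the truncated regression without reference to a singular value decomposition: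
either the Gram matrix is bounded below by `L τ` and the coefficients solve the normal equations,
or the Gram matrix is not bounded below by `L τ`, which shows in the trace of its exponential, and
the coefficients vanish. -/
theorem IsTruncatedCoeff.normal_equations {Y : Fin L → ℝ} {τ : ℝ} {α : Fin K → ℝ}
    (h : IsTruncatedCoeff A Y τ α) {R : ℝ} (hR : 0 < R) :
    ((Aᵀ * A) *ᵥ α = Aᵀ *ᵥ Y ∧ ∀ v, L * τ * (v ⬝ᵥ v) ≤ (A *ᵥ v) ⬝ᵥ (A *ᵥ v)) ∨
    (α = 0 ∧ (¬ ∀ v, L * τ * (v ⬝ᵥ v) ≤ (A *ᵥ v) ⬝ᵥ (A *ᵥ v)) ∧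
      1 ≤ Real.exp (L * τ / R) * (exp (-(R⁻¹ • (Aᵀ * A)))).trace) := by
  obtain ⟨U, s, V, hs, hgood, hbad⟩ := h
  by_cases hk : ∀ k, L * τ ≤ s k ^ 2
  · left
    refine ⟨?_, fun v => ?_⟩
    · rw [hgood hk, mulVec_mulVec, hs.transpose_mul_self, hs.decomp]
      congr 1
      calc U * (diagonal fun k => s k ^ 2) * Uᵀ * (U * rectDiag L (fun k => (s k)⁻¹) * V)
          = U * (diagonal fun k => s k ^ 2) * (Uᵀ * U) * rectDiag L (fun k => (s k)⁻¹) * V := by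
            simp only [Matrix.mul_assoc]
        _ = U * rectDiag L s * V := by
            rw [hs.transpose_left_mul, Matrix.mul_one, Matrix.mul_assoc U, diagonal_mul_rectDiag]
            congr 3
            funext k
            rw [sq]
            exact mul_self_mul_inv (s k)
    · rw [hs.dotProduct_mulVec_eq_sum, hs.dotProduct_self_eq_sum, Finset.mul_sum]
      exact Finset.sum_le_sum fun k _ => mul_le_mul_of_nonneg_right (hk k) (sq_nonneg _)
  · right
    push Not at hk
    obtain ⟨k, hk⟩ := hk
    refine ⟨hbad ⟨k, hk⟩, fun hall => ?_, ?_⟩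
    · have h1 := hall (U *ᵥ Pi.single k 1)
      rw [hs.dotProduct_mulVec_eq_sum, hs.dotProduct_self_eq_sum, mulVec_mulVec,
        hs.transpose_left_mul, one_mulVec] at h1
      simp only [Pi.single_apply, ite_pow, one_pow, ne_eq, OfNat.ofNat_ne_zero, not_false_eq_true,
        zero_pow, mul_ite, mul_one, mul_zero, Finset.sum_ite_eq', Finset.mem_univ, if_true] at h1
      linarith
    · rw [hs.trace_exp_neg_gram, Finset.mul_sum]
      refine le_trans ?_ (Finset.single_le_sum (fun i _ => by positivity) (Finset.mem_univ k))
      rw [← Real.exp_add, Real.one_le_exp_iff]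
      have := mul_le_mul_of_nonneg_left hk.le (inv_pos.2 hR).le
      rw [div_eq_inv_mul]
      linarith

theorem isUnit_det_transpose_mul_self {c : ℝ} (hc : 0 < c)
    (h : ∀ v, c * (v ⬝ᵥ v) ≤ (A *ᵥ v) ⬝ᵥ (A *ᵥ v)) : IsUnit (Aᵀ * A).det := by
  rw [← isUnit_iff_isUnit_det, ← mulVec_injective_iff_isUnit]
  refine (injective_iff_map_eq_zero (mulVecLin (Aᵀ * A))).2 fun v hv => ?_
  have h1 : (A *ᵥ v) ⬝ᵥ (A *ᵥ v) = 0 := by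
    rw [mulVecLin_apply] at hv
    rw [dotProduct_mulVec, vecMul_mulVec, ← dotProduct_mulVec, hv, dotProduct_zero]
  have h2 := h v
  rw [h1] at h2
  have h3 : 0 ≤ v ⬝ᵥ v := Finset.sum_nonneg fun j _ => mul_self_nonneg _
  exact dotProduct_self_eq_zero.1 (le_antisymm (by nlinarith) h3)

/-- Solutions of the normal equations depend on the data in a stable way. -/
theorem sub_dotProduct_self_le {c : ℝ} (hc : 0 < c)
    (h : ∀ v, c * (v ⬝ᵥ v) ≤ (A *ᵥ v) ⬝ᵥ (A *ᵥ v)) {Y : Fin L → ℝ} {α : Fin K → ℝ}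
    (hα : (Aᵀ * A) *ᵥ α = Aᵀ *ᵥ Y) (β : Fin K → ℝ) :
    (α - β) ⬝ᵥ (α - β) ≤ c⁻¹ * ∑ l, (Y l - (A *ᵥ β) l) ^ 2 := by
  set δ := α - β with hδ
  set ρ := Y - A *ᵥ β with hρ
  have hnn : ∀ {m : ℕ} (v : Fin m → ℝ), 0 ≤ v ⬝ᵥ v :=
    fun v => Finset.sum_nonneg fun j _ => mul_self_nonneg _
  have h1 : (Aᵀ * A) *ᵥ δ = Aᵀ *ᵥ ρ := by
    rw [hδ, hρ, mulVec_sub, mulVec_sub, hα, mulVec_mulVec]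
  have h2 : (A *ᵥ δ) ⬝ᵥ (A *ᵥ δ) = (A *ᵥ δ) ⬝ᵥ ρ := by
    rw [dotProduct_mulVec, vecMul_mulVec, ← dotProduct_mulVec, h1, dotProduct_mulVec,
      vecMul_transpose]
  clear_value ρ δ
  have h3 : (A *ᵥ δ) ⬝ᵥ (A *ᵥ δ) ≤ ρ ⬝ᵥ ρ := by
    have h4 := hnn (A *ᵥ δ - ρ)
    rw [sub_dotProduct, dotProduct_sub, dotProduct_sub, dotProduct_comm ρ] at h4
    linarith
  rw [← div_eq_inv_mul, le_div_iff₀ hc, mul_comm]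
  refine (h δ).trans (h3.trans_eq ?_)
  simp [dotProduct, hρ, sq]

end NormalEquations

end SVDRegression

/-! ### The risk of truncated least squares -/

namespace SVDRegression

section Risk

open Matrix NormedSpace
open scoped Matrix.Norms.Operator

variable {K L : ℕ} {𝓧 : Type*} [MeasurableSpace 𝓧] {μ : Measure 𝓧} [IsProbabilityMeasure μ]
  {η : 𝓧 → Fin K → ℝ} {y : 𝓧 → ℝ} {R a b : ℝ}

theorem memLp_dotProduct (hη : Measurable η) (hR : ∀ x, η x ⬝ᵥ η x ≤ R) (v : Fin K → ℝ) :
    MemLp (fun x => v ⬝ᵥ η x) 2 μ := by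
  refine (memLp_two_iff_integrable_sq ?_).2 (integrable_sq_dotProduct hη hR v)
  refine Measurable.aestronglyMeasurable ?_
  simp only [dotProduct]
  fun_prop

omit [IsProbabilityMeasure μ] in
theorem integrable_fun_mul {g h : 𝓧 → ℝ} (hg : MemLp g 2 μ) (hh : MemLp h 2 μ) :
    Integrable (fun x => g x * h x) μ :=
  hg.integrable_mul hh

/-- The residual of the `L²`-projection onto the span of the basis is orthogonal to the span. -/
theorem exists_projection (hη : Measurable η) (hR : ∀ x, η x ⬝ᵥ η x ≤ R) (ha0 : 0 < a)
    (ha : ∀ v : Fin K → ℝ, a * (v ⬝ᵥ v) ≤ ∫ x, (v ⬝ᵥ η x) ^ 2 ∂μ) (hy : MemLp y 2 μ) :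
    ∃ β : Fin K → ℝ, ∀ v : Fin K → ℝ, ∫ x, (y x - β ⬝ᵥ η x) * (v ⬝ᵥ η x) ∂μ = 0 := by
  have hηk : ∀ k, MemLp (fun x => η x k) 2 μ := fun k => by
    simpa using memLp_dotProduct (μ := μ) hη hR (Pi.single k 1)
  set G : Matrix (Fin K) (Fin K) ℝ := of fun k l => ∫ x, η x k * η x l ∂μ with hG
  have hGv : ∀ v k, (G *ᵥ v) k = ∫ x, (v ⬝ᵥ η x) * η x k ∂μ := by
    intro v k
    have h1 : ∀ x, (v ⬝ᵥ η x) * η x k = ∑ l, v l * (η x k * η x l) := fun x => by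
      rw [dotProduct, Finset.sum_mul]
      exact Finset.sum_congr rfl fun l _ => by ring
    simp only [h1]
    rw [integral_finsetSum _ fun l _ => (integrable_fun_mul (hηk k) (hηk l)).const_mul (v l)]
    simp only [integral_const_mul, mulVec, dotProduct, hG, of_apply]
    exact Finset.sum_congr rfl fun l _ => mul_comm _ _
  have hdot : ∀ (g : 𝓧 → ℝ), MemLp g 2 μ → ∀ v : Fin K → ℝ,
      ∫ x, g x * (v ⬝ᵥ η x) ∂μ = ∑ k, v k * ∫ x, g x * η x k ∂μ := by
    intro g hg v
    have h1 : ∀ x, g x * (v ⬝ᵥ η x) = ∑ k, v k * (g x * η x k) := fun x => by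
      rw [dotProduct, Finset.mul_sum]
      exact Finset.sum_congr rfl fun l _ => by ring
    simp only [h1]
    rw [integral_finsetSum _ fun l _ => (integrable_fun_mul hg (hηk l)).const_mul (v l)]
    simp only [integral_const_mul]
  have hinj : Function.Injective G.mulVec := by
    refine (injective_iff_map_eq_zero (mulVecLin G)).2 fun v hv => ?_
    rw [mulVecLin_apply] at hv
    have h1 : ∫ x, (v ⬝ᵥ η x) ^ 2 ∂μ = 0 := by
      simp only [sq]
      rw [hdot _ (memLp_dotProduct hη hR v)]
      refine Finset.sum_eq_zero fun k _ => ?_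
      rw [← hGv, hv]
      simp
    have h2 := ha v
    rw [h1] at h2
    have h3 : 0 ≤ v ⬝ᵥ v := Finset.sum_nonneg fun j _ => mul_self_nonneg _
    exact dotProduct_self_eq_zero.1 (le_antisymm (by nlinarith) h3)
  have hsurj := mulVec_surjective_iff_isUnit.2 (mulVec_injective_iff_isUnit.1 hinj)
  obtain ⟨β, hβ⟩ := hsurj fun k => ∫ x, y x * η x k ∂μ
  refine ⟨β, fun v => ?_⟩
  rw [hdot (fun x => y x - β ⬝ᵥ η x) (hy.sub (memLp_dotProduct hη hR β))]
  refine Finset.sum_eq_zero fun k _ => ?_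
  have h1 := congrFun hβ k
  rw [hGv] at h1
  simp only [sub_mul]
  rw [integral_sub (integrable_fun_mul hy (hηk k))
    (integrable_fun_mul (memLp_dotProduct hη hR β) (hηk k)), h1, sub_self, mul_zero]

/-- Pythagoras for the `L²`-projection. -/
theorem integral_sq_sub_eq (hη : Measurable η) (hR : ∀ x, η x ⬝ᵥ η x ≤ R) (hy : MemLp y 2 μ)
    {β : Fin K → ℝ} (hβ : ∀ v : Fin K → ℝ, ∫ x, (y x - β ⬝ᵥ η x) * (v ⬝ᵥ η x) ∂μ = 0)
    (v : Fin K → ℝ) :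
    ∫ x, (y x - v ⬝ᵥ η x) ^ 2 ∂μ =
      ∫ x, (y x - β ⬝ᵥ η x) ^ 2 ∂μ + ∫ x, ((v - β) ⬝ᵥ η x) ^ 2 ∂μ := by
  have hr : MemLp (fun x => y x - β ⬝ᵥ η x) 2 μ := hy.sub (memLp_dotProduct hη hR β)
  have hδ := memLp_dotProduct (μ := μ) hη hR (v - β)
  have h1 : ∀ x, (y x - v ⬝ᵥ η x) ^ 2 = (y x - β ⬝ᵥ η x) ^ 2 + ((v - β) ⬝ᵥ η x) ^ 2 -
      2 * ((y x - β ⬝ᵥ η x) * ((v - β) ⬝ᵥ η x)) := fun x => by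
    rw [sub_dotProduct]
    ring
  have hi : Integrable (fun x => (y x - β ⬝ᵥ η x) * ((v - β) ⬝ᵥ η x)) μ := hr.integrable_mul hδ
  simp only [h1]
  have hs : Integrable (fun x => (y x - β ⬝ᵥ η x) ^ 2 + ((v - β) ⬝ᵥ η x) ^ 2) μ :=
    hr.integrable_sq.add hδ.integrable_sq
  rw [integral_sub hs (hi.const_mul _),
    integral_add hr.integrable_sq hδ.integrable_sq, integral_const_mul, hβ]
  ring

/-- The squared error is a quadratic polynomial in the coefficients. -/
theorem continuous_integral_sq_sub (hη : Measurable η) (hR : ∀ x, η x ⬝ᵥ η x ≤ R)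
    (hy : MemLp y 2 μ) : Continuous fun v : Fin K → ℝ => ∫ x, (y x - v ⬝ᵥ η x) ^ 2 ∂μ := by
  have hηk : ∀ k, MemLp (fun x => η x k) 2 μ := fun k => by
    simpa using memLp_dotProduct (μ := μ) hη hR (Pi.single k 1)
  have h1 : ∀ (v : Fin K → ℝ) x, (y x - v ⬝ᵥ η x) ^ 2 =
      y x ^ 2 - ∑ k, 2 * v k * (y x * η x k) + ∑ k, ∑ l, v k * v l * (η x k * η x l) := by
    intro v x
    have h2 : ∑ k, 2 * v k * (y x * η x k) = 2 * y x * (v ⬝ᵥ η x) := by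
      rw [dotProduct, Finset.mul_sum]
      exact Finset.sum_congr rfl fun k _ => by ring
    have h3 : ∑ k, ∑ l, v k * v l * (η x k * η x l) = (v ⬝ᵥ η x) * (v ⬝ᵥ η x) := by
      rw [dotProduct, Finset.sum_mul_sum]
      exact Finset.sum_congr rfl fun k _ => Finset.sum_congr rfl fun l _ => by ring
    rw [h2, h3]
    ring
  have h4 : ∀ k l, Integrable (fun x => η x k * η x l) μ := fun k l =>
    (hηk k).integrable_mul (hηk l)
  have h5 : ∀ k, Integrable (fun x => y x * η x k) μ := fun k => hy.integrable_mul (hηk k)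
  have h6 : (fun v : Fin K → ℝ => ∫ x, (y x - v ⬝ᵥ η x) ^ 2 ∂μ) = fun v =>
      ∫ x, y x ^ 2 ∂μ - ∑ k, 2 * v k * ∫ x, y x * η x k ∂μ +
        ∑ k, ∑ l, v k * v l * ∫ x, η x k * η x l ∂μ := by
    funext v
    simp only [h1]
    have i1 : Integrable (fun x => ∑ k, 2 * v k * (y x * η x k)) μ :=
      integrable_finsetSum _ fun k _ => (h5 k).const_mul _
    have i2 : ∀ k, Integrable (fun x => ∑ l, v k * v l * (η x k * η x l)) μ := fun k =>
      integrable_finsetSum _ fun l _ => (h4 k l).const_mul _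
    have i3 : Integrable (fun x => y x ^ 2 - ∑ k, 2 * v k * (y x * η x k)) μ :=
      hy.integrable_sq.sub i1
    rw [integral_add i3 (integrable_finsetSum _ fun k _ => i2 k),
      integral_sub hy.integrable_sq i1, integral_finsetSum _ fun k _ => (h5 k).const_mul _,
      integral_finsetSum _ fun k _ => i2 k]
    simp only [integral_const_mul]
    congr 1
    refine Finset.sum_congr rfl fun k _ => ?_
    rw [integral_finsetSum _ fun l _ => (h4 k l).const_mul _]
    simp only [integral_const_mul]
  rw [h6]
  fun_prop

/-- The regression matrix has the Gram matrix `∑_l η(X_l) η(X_l)ᵀ`. -/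
theorem transpose_mul_self_eq_sum (w : Fin L → Fin K → ℝ) :
    ((of w)ᵀ * of w : Matrix (Fin K) (Fin K) ℝ) = ∑ l, vecMulVec (w l) (w l) := by
  ext i j
  simp [mul_apply, Matrix.sum_apply, vecMulVec_apply]

/-- If the Gram matrix is bounded below by a positive constant, then the solution of the normal
equations is a measurable function of the data; outside of this closed set it is replaced by
zero. -/
theorem measurable_normal_solution (c : ℝ) :
    Measurable fun p : (Fin L → Fin K → ℝ) × (Fin L → ℝ) =>
      open Classical in
      if ∀ v, c * (v ⬝ᵥ v) ≤ (of p.1 *ᵥ v) ⬝ᵥ (of p.1 *ᵥ v) then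
        ((of p.1)ᵀ * of p.1)⁻¹ *ᵥ ((of p.1)ᵀ *ᵥ p.2) else 0 := by
  have hof : Continuous fun p : (Fin L → Fin K → ℝ) × (Fin L → ℝ) => of p.1 :=
    continuous_fst
  have hGc : Continuous fun p : (Fin L → Fin K → ℝ) × (Fin L → ℝ) => (of p.1)ᵀ * of p.1 :=
    hof.matrix_transpose.matrix_mul hof
  refine Measurable.ite ?_ ?_ measurable_const
  · refine IsClosed.measurableSet ?_
    simp only [ofPred_forall]
    refine isClosed_iInter fun v => isClosed_le continuous_const ?_
    exact (hof.matrix_mulVec continuous_const).dotProduct (hof.matrix_mulVec continuous_const)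
  · refine measurable_pi_lambda _ fun k => ?_
    simp only [inv_def, Ring.inverse_eq_inv', smul_mulVec, Pi.smul_apply, smul_eq_mul]
    refine Measurable.mul (hGc.matrix_det.measurable.inv) ?_
    have hc : Continuous fun p : (Fin L → Fin K → ℝ) × (Fin L → ℝ) =>
        ((of p.1)ᵀ * of p.1).adjugate *ᵥ ((of p.1)ᵀ *ᵥ p.2) :=
      hGc.matrix_adjugate.matrix_mulVec (hof.matrix_transpose.matrix_mulVec continuous_snd)
    exact ((continuous_apply k).comp hc).measurable

variable {Ω : Type*} [MeasurableSpace Ω] {P : Measure Ω} {X : Fin L → Ω → 𝓧}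
  {α : Ω → Fin K → ℝ} {τ : ℝ}

omit [IsProbabilityMeasure μ] in
/-- The singular value decomposition may be chosen in a non-measurable way, but the coefficients do
not depend on the choice: they vanish or are the unique solution of the normal equations. -/
theorem aemeasurable_truncatedCoeff (hη : Measurable η) (hy : AEMeasurable y μ)
    (hlaw : ∀ l, HasLaw (X l) μ P) (hL : 0 < L * τ)
    (hα : ∀ ω, IsTruncatedCoeff (of fun l k => η (X l ω) k) (fun l => y (X l ω)) τ (α ω)) :
    AEMeasurable α P := by
  classical
  have hX : AEMeasurable (fun ω => ((fun l => η (X l ω), fun l => y (X l ω)) :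
      (Fin L → Fin K → ℝ) × (Fin L → ℝ))) P := by
    refine AEMeasurable.prodMk (aemeasurable_pi_lambda _ fun l => ?_)
      (aemeasurable_pi_lambda _ fun l => ?_)
    · exact hη.comp_aemeasurable (hlaw l).aemeasurable
    · have hy' : AEMeasurable y (P.map (X l)) := by rwa [(hlaw l).map_eq]
      exact hy'.comp_aemeasurable (hlaw l).aemeasurable
  refine ((measurable_normal_solution (L * τ)).comp_aemeasurable hX).congr
    (ae_of_all _ fun ω => ?_)
  simp only [Function.comp_apply]
  have hA : (of fun l k => η (X l ω) k : Matrix (Fin L) (Fin K) ℝ) = of fun l => η (X l ω) := rfl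
  have h0 := hα ω
  rw [hA] at h0
  rcases h0.normal_equations one_pos with ⟨h1, h2⟩ | ⟨h1, h2, -⟩
  · rw [if_pos h2, ← h1, mulVec_mulVec, nonsing_inv_mul _ (isUnit_det_transpose_mul_self hL h2),
      one_mulVec]
  · rw [if_neg h2, h1]

/-- The risk of truncated least squares. The first term is the squared approximation error of the
basis, amplified by the stability constant of the normal equations; the second one is the
probability of truncation, bounded by the matrix Chernoff inequality, times the error of the zero
function. -/
theorem integral_truncated_le (hη : Measurable η) (hR0 : 0 < R)
    (hR : ∀ x, η x ⬝ᵥ η x ≤ R) (ha0 : 0 < a)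
    (ha : ∀ v : Fin K → ℝ, a * (v ⬝ᵥ v) ≤ ∫ x, (v ⬝ᵥ η x) ^ 2 ∂μ)
    (hb : ∀ v : Fin K → ℝ, ∫ x, (v ⬝ᵥ η x) ^ 2 ∂μ ≤ b * (v ⬝ᵥ v)) (hb0 : 0 ≤ b)
    (hy : MemLp y 2 μ) [IsProbabilityMeasure P]
    (hX : iIndepFun X P) (hlaw : ∀ l, HasLaw (X l) μ P) (hτ : 0 < τ) (hL : 0 < L)
    (hα : ∀ ω, IsTruncatedCoeff (of fun l k => η (X l ω) k) (fun l => y (X l ω)) τ (α ω))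
    {B : ℝ} {β₀ : Fin K → ℝ} (hB : ∀ᵐ x ∂μ, |y x - β₀ ⬝ᵥ η x| ≤ B) :
    Integrable (fun ω => ∫ x, (y x - α ω ⬝ᵥ η x) ^ 2 ∂μ) P ∧
    ∫ ω, ∫ x, (y x - α ω ⬝ᵥ η x) ^ 2 ∂μ ∂P ≤
      B ^ 2 * (1 + b / τ) +
        min 1 (K * Real.exp (L * (τ / R - a / (2 * R)))) * ∫ x, y x ^ 2 ∂μ := by
  have hLR : (0 : ℝ) < L := Nat.cast_pos.2 hL
  obtain ⟨β, hβ⟩ := exists_projection hη hR ha0 ha hy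
  have hpyth := integral_sq_sub_eq hη hR hy hβ
  have hr : MemLp (fun x => y x - β ⬝ᵥ η x) 2 μ := hy.sub (memLp_dotProduct hη hR β)
  set r : 𝓧 → ℝ := fun x => y x - β ⬝ᵥ η x with hrdef
  set ρ := ∫ x, r x ^ 2 ∂μ with hρ
  set I := ∫ x, y x ^ 2 ∂μ with hI
  have hI0 : 0 ≤ I := integral_nonneg fun x => sq_nonneg _
  have hρB : ρ ≤ B ^ 2 := by
    have h1 : ρ ≤ ∫ x, (y x - β₀ ⬝ᵥ η x) ^ 2 ∂μ := by
      rw [hpyth β₀]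
      exact le_add_of_nonneg_right (integral_nonneg fun x => sq_nonneg _)
    refine h1.trans ?_
    have h2 : ∫ x, (y x - β₀ ⬝ᵥ η x) ^ 2 ∂μ ≤ ∫ _, B ^ 2 ∂μ := by
      refine integral_mono_ae (hy.sub (memLp_dotProduct hη hR β₀)).integrable_sq
        (integrable_const _) ?_
      filter_upwards [hB] with x hx
      exact sq_le_sq' (neg_le_of_abs_le hx) (le_of_abs_le hx)
    simpa using h2
  set g : Ω → ℝ := fun ω =>
    (exp (-(R⁻¹ • ∑ l, vecMulVec (η (X l ω)) (η (X l ω))))).trace with hg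
  obtain ⟨hgint, hgle⟩ := integral_trace_exp_neg_gram_le hη hR0 hR ha hX hlaw
  have hg0 : ∀ ω, 0 ≤ g ω := fun ω => trace_exp_nonneg (isSymm_neg_gram _ _)
  set Q : Ω → ℝ := fun ω => b * (L * τ)⁻¹ * ∑ l, r (X l ω) ^ 2 with hQ
  have hrl : ∀ l, Integrable (fun ω => r (X l ω) ^ 2) P ∧ ∫ ω, r (X l ω) ^ 2 ∂P = ρ := by
    intro l
    have h1 : Integrable (fun x => r x ^ 2) (P.map (X l)) := by
      rw [(hlaw l).map_eq]
      exact hr.integrable_sq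
    refine ⟨h1.comp_aemeasurable (hlaw l).aemeasurable, ?_⟩
    exact (hlaw l).integral_comp hr.integrable_sq.aestronglyMeasurable
  have hQint : Integrable Q P :=
    (integrable_finsetSum _ fun l _ => (hrl l).1).const_mul _
  have hQ0 : ∀ ω, 0 ≤ Q ω := fun ω => by
    have : 0 ≤ ∑ l, r (X l ω) ^ 2 := Finset.sum_nonneg fun l _ => sq_nonneg _
    positivity
  have hQle : ∫ ω, Q ω ∂P = b / τ * ρ := by
    rw [hQ, integral_const_mul, integral_finsetSum _ fun l _ => (hrl l).1]
    simp only [(hrl _).2, Finset.sum_const, Finset.card_univ, Fintype.card_fin, nsmul_eq_mul]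
    field_simp
  set E : Ω → ℝ := fun ω => ∫ x, (y x - α ω ⬝ᵥ η x) ^ 2 ∂μ with hE
  have hE0 : ∀ ω, 0 ≤ E ω := fun ω => integral_nonneg fun x => sq_nonneg _
  have hpt : ∀ ω, E ω ≤ ρ + Q ω ∨
      (E ω = I ∧ 1 ≤ Real.exp (L * τ / R) * g ω) := by
    intro ω
    rcases (hα ω).normal_equations hR0 with ⟨h1, h2⟩ | ⟨h1, -, h3⟩
    · left
      simp only [hE]
      rw [hpyth (α ω)]
      refine add_le_add le_rfl ((hb _).trans ?_)
      simp only [hQ]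
      rw [mul_assoc]
      refine mul_le_mul_of_nonneg_left ?_ hb0
      refine (sub_dotProduct_self_le (by positivity) h2 h1 β).trans_eq ?_
      congr 1
      refine Finset.sum_congr rfl fun l _ => ?_
      simp only [hrdef, mulVec, of_apply]
      rw [dotProduct_comm β]
    · right
      refine ⟨?_, ?_⟩
      · simp [hE, h1, hI]
      · have h4 := transpose_mul_self_eq_sum (fun l => η (X l ω))
        have hA : (of fun l k => η (X l ω) k : Matrix (Fin L) (Fin K) ℝ) =
          of fun l => η (X l ω) := rfl
        rwa [hA, h4] at h3
  have hρ0 : 0 ≤ ρ := integral_nonneg fun x => sq_nonneg _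
  have hb1 : ∀ ω, E ω ≤ ρ + Q ω + I := fun ω => by
    rcases hpt ω with h | ⟨h, -⟩ <;> linarith [hQ0 ω]
  have hb2 : ∀ ω, E ω ≤ ρ + Q ω + Real.exp (L * τ / R) * g ω * I := fun ω => by
    rcases hpt ω with h | ⟨h, h'⟩
    · have : 0 ≤ Real.exp (L * τ / R) * g ω * I :=
        mul_nonneg (mul_nonneg (Real.exp_pos _).le (hg0 ω)) hI0
      linarith
    · linarith [hQ0 ω, mul_le_mul_of_nonneg_right h' hI0]
  have hαm := aemeasurable_truncatedCoeff hη hy.aestronglyMeasurable.aemeasurable hlaw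
    (by positivity) hα
  have hEm : AEStronglyMeasurable E P :=
    ((continuous_integral_sq_sub hη hR hy).measurable.comp_aemeasurable hαm).aestronglyMeasurable
  have hbint : Integrable (fun ω => ρ + Q ω + I) P :=
    ((integrable_const _).add hQint).add (integrable_const _)
  have hEint : Integrable E P := hbint.mono' hEm (ae_of_all _ fun ω => by
    rw [Real.norm_of_nonneg (hE0 ω)]
    exact hb1 ω)
  refine ⟨hEint, ?_⟩
  have hmain : ρ + b / τ * ρ ≤ B ^ 2 * (1 + b / τ) := by
    have : 0 ≤ 1 + b / τ := by positivity
    nlinarith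
  have hρQ : Integrable (fun ω => ρ + Q ω) P := (integrable_const _).add hQint
  have hρQi : ∫ ω, (ρ + Q ω) ∂P = ρ + b / τ * ρ := by
    rw [integral_add (integrable_const _) hQint, hQle]
    simp
  rw [min_mul_of_nonneg _ _ hI0, add_comm, ← min_add_add_right]
  refine le_min ?_ ?_
  · have h1 := integral_mono hEint hbint hb1
    rw [integral_add hρQ (integrable_const _), hρQi] at h1
    simp only [integral_const, probReal_univ, one_smul] at h1
    linarith
  · have hgi : Integrable (fun ω => Real.exp (L * τ / R) * g ω * I) P :=
      (hgint.const_mul _).mul_const _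
    have h1 := integral_mono hEint (hρQ.add hgi) hb2
    have h2 : ∫ ω, (ρ + Q ω + Real.exp (L * τ / R) * g ω * I) ∂P =
        ρ + b / τ * ρ + Real.exp (L * τ / R) * (∫ ω, g ω ∂P) * I := by
      rw [integral_add hρQ hgi, hρQi, integral_mul_const, integral_const_mul]
    have h3 : Real.exp (L * τ / R) * (∫ ω, g ω ∂P) ≤
        K * Real.exp (L * (τ / R - a / (2 * R))) := by
      refine (mul_le_mul_of_nonneg_left hgle (Real.exp_pos _).le).trans_eq ?_
      rw [Fintype.card_fin, mul_left_comm, ← Real.exp_add]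
      congr 2
      ring
    have h4 := mul_le_mul_of_nonneg_right h3 hI0
    have h5 : ∫ ω, E ω ∂P ≤ ρ + b / τ * ρ + Real.exp (L * τ / R) * (∫ ω, g ω ∂P) * I :=
      h1.trans_eq h2
    linarith

end Risk

end SVDRegression

/-! ### Legendre polynomials on the unit interval -/

namespace SVDRegression

section Legendre

open Polynomial

/-- The polynomial `t ↦ P_q(2t - 1)`, where `P_q` is the Legendre polynomial of degree `q`. Up to
sign, this is Mathlib's `Polynomial.shiftedLegendre q`. -/
noncomputable def unitLegendre (q : ℕ) : ℝ[X] :=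
  C ((-1) ^ q) * (shiftedLegendre q).map (Int.castRingHom ℝ)

theorem coeff_unitLegendre (q k : ℕ) :
    (unitLegendre q).coeff k = (-1) ^ q * ((-1) ^ k * q.choose k * (q + k).choose q) := by
  rw [unitLegendre, coeff_C_mul, coeff_map, coeff_shiftedLegendre]
  simp

theorem degree_unitLegendre (q : ℕ) : (unitLegendre q).degree = q := by
  rw [unitLegendre, degree_C_mul (by simp), degree_map_eq_of_injective
    (RingHom.injective_int _), degree_shiftedLegendre]

theorem eval_zero_unitLegendre (q : ℕ) : (unitLegendre q).eval 0 = (-1) ^ q := by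
  rw [← coeff_zero_eq_eval_zero, coeff_unitLegendre]
  simp

theorem eval_one_unitLegendre (q : ℕ) : (unitLegendre q).eval 1 = 1 := by
  have h := shiftedLegendre_eval_symm q (1 : ℝ)
  rw [unitLegendre, eval_mul, eval_C, eval_map, ← algebraMap_int_eq, ← aeval_def, h, sub_self,
    aeval_def, algebraMap_int_eq, ← eval_map, ← coeff_zero_eq_eval_zero, coeff_map,
    coeff_shiftedLegendre]
  simp [← mul_pow]

/-- The differential equation of the Legendre polynomials on the unit interval. -/
theorem unitLegendre_ode (q : ℕ) :
    X * (1 - X) * derivative (derivative (unitLegendre q)) +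
      (1 - 2 * X) * derivative (unitLegendre q) + C ((q : ℝ) * (q + 1)) * unitLegendre q = 0 := by
  have h : X * (1 - X) * derivative (derivative (unitLegendre q)) +
      (1 - 2 * X) * derivative (unitLegendre q) + C ((q : ℝ) * (q + 1)) * unitLegendre q =
      X * derivative (derivative (unitLegendre q)) -
        X * (X * derivative (derivative (unitLegendre q))) + derivative (unitLegendre q) -
        C 2 * (X * derivative (unitLegendre q)) +
        C ((q : ℝ) * (q + 1)) * unitLegendre q := by
    rw [show (C (2 : ℝ) : ℝ[X]) = 2 from rfl]
    ring
  rw [h]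
  ext k
  have key : ((k : ℝ) + 1) ^ 2 * (unitLegendre q).coeff (k + 1) =
      (k * (k + 1) - q * (q + 1)) * (unitLegendre q).coeff k := by
    rw [coeff_unitLegendre, coeff_unitLegendre]
    have h1 : ((q.choose (k + 1) : ℕ) : ℝ) * (k + 1) = q.choose k * (q - k) := by
      rcases le_or_gt k q with hk | hk
      · rw [← Nat.cast_sub hk]
        exact_mod_cast Nat.choose_succ_right_eq q k
      · rw [Nat.choose_eq_zero_of_lt hk, Nat.choose_eq_zero_of_lt (by omega)]
        simp
    have h2 : (((q + (k + 1)).choose q : ℕ) : ℝ) * (k + 1) = (q + k).choose q * (q + k + 1) := by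
      have := Nat.choose_mul_succ_eq (q + k) q
      rw [show q + k + 1 - q = k + 1 by omega] at this
      rw [← add_assoc]
      exact_mod_cast this.symm
    rw [pow_succ (-1 : ℝ) k]
    linear_combination (-(-1 : ℝ) ^ q * (-1) ^ k * ((q + (k + 1)).choose q) * (k + 1)) * h1 -
      (-1 : ℝ) ^ q * (-1) ^ k * (q.choose k) * (q - k) * h2
  generalize (q : ℝ) * (q + 1) = c at key ⊢
  cases k with
  | zero =>
    simp [coeff_derivative] at key ⊢
    linarith
  | succ k =>
    cases k with
    | zero =>
      simp [coeff_derivative] at key ⊢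
      linarith
    | succ k =>
      simp [coeff_derivative] at key ⊢
      linarith

theorem iterate_derivative_comp_two_X_sub_one (p : ℝ[X]) (k : ℕ) :
    derivative^[k] (p.comp (2 * X - 1)) = 2 ^ k * (derivative^[k] p).comp (2 * X - 1) := by
  induction k generalizing p with
  | zero => simp
  | succ k ih =>
    have h : derivative (p.comp (2 * X - 1)) = ((2 : ℝ) • derivative p).comp (2 * X - 1) := by
      rw [derivative_comp]
      simp [smul_eq_C_mul, show (C (2 : ℝ) : ℝ[X]) = 2 from rfl]
    rw [Function.iterate_succ_apply, h, ih, iterate_derivative_smul, Function.iterate_succ_apply,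
      smul_comp, smul_eq_C_mul, pow_succ]
    rw [show (C (2 : ℝ) : ℝ[X]) = 2 from rfl]
    ring

/-- Rodrigues' formula. -/
theorem legendre_rodrigues (q : ℕ) (x : ℝ) :
    2 ^ q * (q.factorial : ℝ) * legendre q x =
      (derivative^[q] ((X ^ 2 - 1 : ℝ[X]) ^ q)).eval x := by
  have hexp : (X ^ 2 - 1 : ℝ[X]) ^ q =
      ∑ r ∈ Finset.range (q + 1), C ((-1) ^ r * (q.choose r : ℝ)) * X ^ (2 * (q - r)) := by
    rw [sub_eq_neg_add, add_pow]
    refine Finset.sum_congr rfl fun r _ => ?_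
    rw [← pow_mul]
    simp
    ring
  rw [hexp, iterate_derivative_sum, eval_finsetSum, legendre, ← mul_assoc]
  have hsub : Finset.range (q / 2 + 1) ⊆ Finset.range (q + 1) :=
    Finset.range_subset_range.2 (by omega)
  rw [← Finset.sum_subset hsub, Finset.mul_sum]
  · refine Finset.sum_congr rfl fun r hr => ?_
    have hr' : 2 * r ≤ q := by
      have := Finset.mem_range.1 hr
      omega
    rw [iterate_derivative_C_mul, iterate_derivative_X_pow_eq_smul]
    simp only [eval_mul, eval_C, eval_smul, eval_pow, eval_X, smul_eq_mul]
    have h1 : (2 * (q - r)).descFactorial q * (q - 2 * r).factorial =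
        (2 * q - 2 * r).factorial := by
      rw [mul_comm, show q - 2 * r = 2 * (q - r) - q by omega,
        Nat.factorial_mul_descFactorial (by omega)]
      congr 1
      omega
    have h2 : q.choose r * r.factorial * (q - r).factorial = q.factorial :=
      Nat.choose_mul_factorial_mul_factorial (by omega)
    rw [← h1, ← h2, show 2 * (q - r) - q = q - 2 * r by omega]
    have e1 : ((r.factorial : ℕ) : ℝ) ≠ 0 := by positivity
    have e2 : (((q - r).factorial : ℕ) : ℝ) ≠ 0 := by positivity
    have e3 : (((q - 2 * r).factorial : ℕ) : ℝ) ≠ 0 := by positivity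
    push_cast
    field_simp
  · intro r hr hr'
    have hlt : 2 * (q - r) < q := by
      have := Finset.mem_range.1 hr
      have := mt Finset.mem_range.2 hr'
      omega
    rw [iterate_derivative_C_mul, iterate_derivative_X_pow_eq_smul,
      Nat.descFactorial_eq_zero_iff_lt.2 hlt]
    simp

theorem eval_unitLegendre (q : ℕ) (t : ℝ) :
    (unitLegendre q).eval t = legendre q (2 * t - 1) := by
  have h1 := congrArg (fun p : ℤ[X] => p.map (Int.castRingHom ℝ))
    (factorial_mul_shiftedLegendre_eq q)
  simp only [Polynomial.map_mul, Polynomial.map_natCast, ← iterate_derivative_map,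
    Polynomial.map_pow, Polynomial.map_sub, Polynomial.map_one, map_X] at h1
  have h2 : ((X ^ 2 - 1 : ℝ[X]) ^ q).comp (2 * X - 1) =
      C ((-4) ^ q) * (X ^ q * (1 - X) ^ q) := by
    simp only [pow_comp, sub_comp, X_comp, one_comp]
    rw [← mul_pow, C_pow, ← mul_pow]
    congr 1
    rw [show (C (-4 : ℝ) : ℝ[X]) = -4 by rw [C_neg]; rfl]
    ring
  have h3 := iterate_derivative_comp_two_X_sub_one ((X ^ 2 - 1 : ℝ[X]) ^ q) q
  rw [h2, iterate_derivative_C_mul, ← h1] at h3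
  have h4 := congrArg (eval t) h3
  simp only [eval_mul, eval_C, eval_natCast, eval_comp, eval_sub, eval_X, eval_one, eval_pow,
    eval_ofNat] at h4
  rw [← legendre_rodrigues, show (-4 : ℝ) = (-1) * 2 * 2 by norm_num, mul_pow, mul_pow] at h4
  rw [unitLegendre, eval_mul, eval_C]
  have e1 : (q.factorial : ℝ) ≠ 0 := by positivity
  have e2 : (2 : ℝ) ^ q ≠ 0 := by positivity
  have : (2 : ℝ) ^ q * 2 ^ q * q.factorial ≠ 0 := by positivity
  refine mul_left_cancel₀ this ?_
  linear_combination h4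

/-! #### Orthogonality -/

theorem integral_derivative_eq (p : ℝ[X]) :
    ∫ t in (0 : ℝ)..1, (derivative p).eval t = p.eval 1 - p.eval 0 :=
  intervalIntegral.integral_eq_sub_of_hasDerivAt (fun t _ => p.hasDerivAt t)
    ((derivative p).continuous.intervalIntegrable _ _)

theorem integral_unitLegendre_mul_of_ne {m q : ℕ} (h : m ≠ q) :
    ∫ t in (0 : ℝ)..1, (unitLegendre m * unitLegendre q).eval t = 0 := by
  -- the Wronskian weighted by `t (1 - t)`, whose derivative is a multiple of the product
  have hW := integral_derivative_eq (X * (1 - X) * (derivative (unitLegendre m) * unitLegendre q -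
    unitLegendre m * derivative (unitLegendre q)))
  have hd : derivative (X * (1 - X) * (derivative (unitLegendre m) * unitLegendre q -
      unitLegendre m * derivative (unitLegendre q))) =
      C ((q : ℝ) * (q + 1) - m * (m + 1)) * (unitLegendre m * unitLegendre q) := by
    simp only [derivative_mul, derivative_sub, derivative_X, derivative_one, C_sub]
    linear_combination unitLegendre q * unitLegendre_ode m - unitLegendre m * unitLegendre_ode q
  rw [hd] at hW
  simp only [eval_mul, eval_C, eval_sub, eval_one, eval_X, sub_self, mul_zero, zero_mul] at hW
  rw [intervalIntegral.integral_const_mul] at hW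
  have hne : (q : ℝ) * (q + 1) - m * (m + 1) ≠ 0 := by
    have : (q : ℝ) * (q + 1) - m * (m + 1) = (q - m) * (q + m + 1) := by ring
    rw [this]
    refine mul_ne_zero (sub_ne_zero.2 (by exact_mod_cast h.symm)) (by positivity)
  simpa [hne] using hW

/-- The Legendre polynomials as a sequence of polynomials of increasing degree. -/
noncomputable def unitLegendreSequence : Polynomial.Sequence ℝ where
  elems' := unitLegendre
  degree_eq' := degree_unitLegendre

theorem span_unitLegendre (m : ℕ) :
    Submodule.span ℝ (unitLegendre '' Set.Iic m) = degreeLE ℝ m := by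
  refine unitLegendreSequence.span_degreeLE fun i _ => ?_
  exact (leadingCoeff_ne_zero.2 (unitLegendreSequence.ne_zero i)).isUnit

theorem integral_unitLegendre_mul_of_degree_lt {q : ℕ} {p : ℝ[X]} (hp : p.degree < q) :
    ∫ t in (0 : ℝ)..1, (unitLegendre q * p).eval t = 0 := by
  cases q with
  | zero =>
    have : p = 0 := by simpa using hp
    simp [this]
  | succ m =>
    have hp' : p ∈ Submodule.span ℝ (unitLegendre '' Set.Iic m) := by
      rw [span_unitLegendre, mem_degreeLE]
      exact Order.lt_succ_iff.1 hp
    clear hp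
    induction hp' using Submodule.span_induction with
    | mem p h =>
      obtain ⟨i, hi, rfl⟩ := h
      exact integral_unitLegendre_mul_of_ne (by have : i ≤ m := hi; omega)
    | zero => simp
    | add p₁ p₂ _ _ h₁ h₂ =>
      simp only [mul_add, eval_add]
      rw [intervalIntegral.integral_add (Polynomial.continuous _ |>.intervalIntegrable _ _)
        (Polynomial.continuous _ |>.intervalIntegrable _ _), h₁, h₂, add_zero]
    | smul c p _ h =>
      simp only [mul_smul_comm, eval_smul, smul_eq_mul]
      rw [intervalIntegral.integral_const_mul, h, mul_zero]

theorem integral_unitLegendre_sq (q : ℕ) :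
    ∫ t in (0 : ℝ)..1, (unitLegendre q * unitLegendre q).eval t = 1 / (2 * q + 1) := by
  set p := unitLegendre q with hp
  -- `t p' = q p +` terms of lower degree, and `((2t - 1) p²)' = 2 p² + 2 (2t - 1) p p'`
  have hd : derivative ((2 * X - 1) * (p * p)) = C (2 * (2 * (q : ℝ) + 1)) * (p * p) +
      p * (C 4 * (X * derivative p - C (q : ℝ) * p) - C 2 * derivative p) := by
    simp only [derivative_mul, derivative_sub, derivative_one, derivative_X, C_mul, C_add, C_1,
      show (C (2 : ℝ) : ℝ[X]) = 2 from rfl, show (C (4 : ℝ) : ℝ[X]) = 4 from rfl,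
      derivative_ofNat]
    ring
  have hdeg : (C 4 * (X * derivative p - C (q : ℝ) * p) - C 2 * derivative p).degree <
      (q : WithBot ℕ) := by
    rw [degree_lt_iff_coeff_zero]
    intro m hm
    have hz : ∀ j, q < j → p.coeff j = 0 := fun j hj =>
      coeff_eq_zero_of_degree_lt (by rw [hp, degree_unitLegendre]; exact_mod_cast hj)
    have h1 : (derivative p).coeff m = 0 := by
      rw [coeff_derivative, hz _ (by omega), zero_mul]
    have h2 : (X * derivative p - C (q : ℝ) * p).coeff m = 0 := by
      rw [coeff_sub, coeff_C_mul]
      cases m with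
      | zero =>
        have : q = 0 := by omega
        simp [this]
      | succ m =>
        rw [coeff_X_mul, coeff_derivative]
        rcases hm.eq_or_lt with h | h
        · rw [h]
          push_cast
          ring
        · rw [hz _ (by omega)]
          ring
    rw [coeff_sub, coeff_C_mul, coeff_C_mul, h1, h2]
    ring
  have hI := integral_derivative_eq ((2 * X - 1) * (p * p))
  rw [hd] at hI
  simp only [eval_add, eval_mul (p := C (2 * (2 * (q : ℝ) + 1)))] at hI
  rw [intervalIntegral.integral_add
    ((continuous_const.mul (p * p).continuous |>.congr fun t => by simp only [eval_C]; rfl :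
      Continuous fun t => eval t (C (2 * (2 * (q : ℝ) + 1))) * eval t (p * p)).intervalIntegrable
        _ _)
    (Polynomial.continuous _ |>.intervalIntegrable _ _),
    integral_unitLegendre_mul_of_degree_lt hdeg] at hI
  simp only [eval_C] at hI
  rw [intervalIntegral.integral_const_mul] at hI
  have v1 : eval 1 p * eval 1 p = 1 := by rw [hp, eval_one_unitLegendre, mul_one]
  have v0 : eval 0 p * eval 0 p = 1 := by
    rw [hp, eval_zero_unitLegendre, ← mul_pow]
    norm_num
  simp only [eval_mul, eval_sub, eval_X, eval_one, eval_ofNat, v1, v0] at hI ⊢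
  have h0 : (2 * (q : ℝ) + 1) ≠ 0 := by positivity
  rw [eq_div_iff h0]
  linarith

/-! #### The uniform bound -/

/-- On the unit interval, the Legendre polynomials are bounded by one. By the differential
equation, `p² + t(1-t) p'² / (q(q+1))` decreases on `[0,1/2]` and increases on `[1/2,1]`, and it
equals one at both endpoints. -/
theorem sq_eval_unitLegendre_le_one (q : ℕ) {t : ℝ} (ht : t ∈ Icc (0 : ℝ) 1) :
    (unitLegendre q).eval t ^ 2 ≤ 1 := by
  rcases Nat.eq_zero_or_pos q with rfl | hq
  · have h1 : unitLegendre 0 = 1 := by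
      ext k
      rw [coeff_unitLegendre, coeff_one]
      cases k <;> simp
    simp [h1]
  have hq' : (0 : ℝ) < q := Nat.cast_pos.2 hq
  set p := unitLegendre q with hp
  set c : ℝ := (q : ℝ) * (q + 1) with hc
  have hc0 : 0 < c := by positivity
  set φ : ℝ[X] := C c * (p * p) + X * (1 - X) * (derivative p * derivative p) with hφ
  have hφd : derivative φ = (2 * X - 1) * (derivative p * derivative p) := by
    have h := unitLegendre_ode q
    simp only [hφ, derivative_add, derivative_mul, derivative_sub, derivative_one, derivative_X,
      derivative_C]
    linear_combination 2 * derivative p * h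
  have hφ0 : φ.eval 0 = c := by
    simp [hφ, hp, eval_zero_unitLegendre, ← mul_pow]
  have hφ1 : φ.eval 1 = c := by
    simp [hφ, hp, eval_one_unitLegendre]
  have hle : φ.eval t ≤ c := by
    rcases le_total t (1 / 2) with h | h
    · have hanti : AntitoneOn (fun s => φ.eval s) (Icc 0 (1 / 2)) := by
        refine antitoneOn_of_deriv_nonpos (convex_Icc _ _) φ.continuous.continuousOn
          φ.differentiable.differentiableOn fun s hs => ?_
        rw [interior_Icc] at hs
        rw [Polynomial.deriv, hφd, eval_mul]
        refine mul_nonpos_of_nonpos_of_nonneg ?_ (by rw [eval_mul]; exact mul_self_nonneg _)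
        simp
        linarith [hs.2]
      rw [← hφ0]
      exact hanti ⟨le_rfl, by norm_num⟩ ⟨ht.1, h⟩ ht.1
    · have hmono : MonotoneOn (fun s => φ.eval s) (Icc (1 / 2) 1) := by
        refine monotoneOn_of_deriv_nonneg (convex_Icc _ _) φ.continuous.continuousOn
          φ.differentiable.differentiableOn fun s hs => ?_
        rw [interior_Icc] at hs
        rw [Polynomial.deriv, hφd, eval_mul]
        refine mul_nonneg ?_ (by rw [eval_mul]; exact mul_self_nonneg _)
        simp
        linarith [hs.1]
      rw [← hφ1]
      exact hmono ⟨h, ht.2⟩ ⟨by norm_num, le_rfl⟩ ht.2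
  have h2 : c * p.eval t ^ 2 ≤ φ.eval t := by
    simp only [hφ, eval_add, eval_mul, eval_C, eval_X, eval_sub, eval_one]
    have : 0 ≤ t * (1 - t) * (eval t (derivative p) * eval t (derivative p)) :=
      mul_nonneg (mul_nonneg ht.1 (by linarith [ht.2])) (mul_self_nonneg _)
    nlinarith
  nlinarith

/-- The values of the Legendre polynomials on `[-1,1]`, parametrized by `t ↦ 2t - 1`. -/
theorem legendre_sq_le_one (q : ℕ) {t : ℝ} (ht : t ∈ Icc (0 : ℝ) 1) :
    legendre q (2 * t - 1) ^ 2 ≤ 1 := by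
  rw [← eval_unitLegendre]
  exact sq_eval_unitLegendre_le_one q ht

theorem integral_legendre_mul (m q : ℕ) :
    ∫ t in (0 : ℝ)..1, legendre m (2 * t - 1) * legendre q (2 * t - 1) =
      if m = q then 1 / (2 * (q : ℝ) + 1) else 0 := by
  simp only [← eval_unitLegendre, ← eval_mul]
  split_ifs with h
  · rw [h, integral_unitLegendre_sq]
  · exact integral_unitLegendre_mul_of_ne h

theorem continuous_legendre (q : ℕ) : Continuous (legendre q) := by
  unfold legendre
  fun_prop

theorem exists_pow_eq_sum_legendre (m : ℕ) :
    ∃ c : ℕ → ℝ, ∀ t : ℝ, t ^ m = ∑ j ∈ Finset.range (m + 1), c j * legendre j (2 * t - 1) := by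
  have h : (X ^ m : ℝ[X]) ∈ Submodule.span ℝ (unitLegendre '' Set.Iic m) := by
    rw [span_unitLegendre, mem_degreeLE]
    exact degree_X_pow_le m
  have hset : (Set.Iic m : Set ℕ) = (Finset.range (m + 1) : Finset ℕ) := by
    ext j
    simp
  rw [hset, Submodule.mem_span_image_finset_iff_exists_fun'] at h
  obtain ⟨c, hc⟩ := h
  refine ⟨c, fun t => ?_⟩
  have h1 := congrArg (eval t) hc
  rw [eval_finsetSum] at h1
  simp only [eval_smul, eval_pow, eval_X, smul_eq_mul, eval_unitLegendre] at h1
  exact h1.symm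

end Legendre

end SVDRegression

/-! ### The piecewise Legendre basis -/

namespace SVDRegression

section Basis

variable {D N Q : ℕ}

/-- The one-dimensional factors of the basis functions: a normalized Legendre polynomial on the
interval `(i/N, (i+1)/N]`, extended by zero. -/
noncomputable def intervalLegendre (N i j : ℕ) : ℝ → ℝ :=
  (Ioc ((i : ℝ) / N) (((i : ℝ) + 1) / N)).indicator fun t =>
    √N * (√(2 * (j : ℝ) + 1) * legendre j (2 * (N * t - i) - 1))

theorem basisFun_eq_prod (b : BasisIndex D N Q) (x : Fin D → ℝ) :
    basisFun b x = ∏ d, intervalLegendre N (b.1 d) (b.2.1 d) (x d) := by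
  have hN : (N : ℝ) ^ ((D : ℝ) / 2) = ∏ _d : Fin D, √(N : ℝ) := by
    rw [Finset.prod_const, Finset.card_univ, Fintype.card_fin, Real.sqrt_eq_rpow,
      ← Real.rpow_natCast, ← Real.rpow_mul (Nat.cast_nonneg N)]
    congr 1
    ring
  by_cases hx : x ∈ gridCube b.1
  · rw [basisFun, indicator_of_mem hx, hN, ← Finset.prod_mul_distrib]
    refine Finset.prod_congr rfl fun d _ => ?_
    rw [intervalLegendre, indicator_of_mem]
    exact hx d
  · rw [basisFun, indicator_of_notMem hx]
    have hx' : ∃ d, x d ∉ Ioc (((b.1 d : ℕ) : ℝ) / N) ((((b.1 d : ℕ) : ℝ) + 1) / N) := by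
      by_contra h
      push Not at h
      exact hx h
    obtain ⟨d, hd⟩ := hx'
    refine (Finset.prod_eq_zero (Finset.mem_univ d) ?_).symm
    rw [intervalLegendre, indicator_of_notMem hd]

theorem natCast_eq_of_mem_Ioc (hN : 0 < N) {i i' : ℕ} {t : ℝ}
    (h : t ∈ Ioc ((i : ℝ) / N) (((i : ℝ) + 1) / N))
    (h' : t ∈ Ioc ((i' : ℝ) / N) (((i' : ℝ) + 1) / N)) : i = i' := by
  have hN' : (0 : ℝ) < N := Nat.cast_pos.2 hN
  have h1 : (i : ℝ) < i' + 1 := (div_lt_div_iff_of_pos_right hN').1 (h.1.trans_le h'.2)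
  have h2 : (i' : ℝ) < i + 1 := (div_lt_div_iff_of_pos_right hN').1 (h'.1.trans_le h.2)
  have h3 : i < i' + 1 := by exact_mod_cast h1
  have h4 : i' < i + 1 := by exact_mod_cast h2
  omega

theorem integral_intervalLegendre_mul (hN : 0 < N) (i i' j j' : ℕ) :
    ∫ t, intervalLegendre N i j t * intervalLegendre N i' j' t =
      if i = i' ∧ j = j' then 1 else 0 := by
  have hN' : (0 : ℝ) < N := Nat.cast_pos.2 hN
  by_cases hi : i = i'
  · subst hi
    have h1 : ∀ t, intervalLegendre N i j t * intervalLegendre N i j' t =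
        (Ioc ((i : ℝ) / N) (((i : ℝ) + 1) / N)).indicator
          (fun t => (N * (√(2 * (j : ℝ) + 1) * √(2 * (j' : ℝ) + 1))) *
            (legendre j (2 * (N * t - i) - 1) * legendre j' (2 * (N * t - i) - 1))) t := by
      intro t
      rw [intervalLegendre, intervalLegendre]
      by_cases ht : t ∈ Ioc ((i : ℝ) / N) (((i : ℝ) + 1) / N)
      · rw [indicator_of_mem ht, indicator_of_mem ht, indicator_of_mem ht]
        have := Real.mul_self_sqrt hN'.le
        linear_combination (√(2 * (j : ℝ) + 1) * legendre j (2 * (N * t - i) - 1) *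
          (√(2 * (j' : ℝ) + 1) * legendre j' (2 * (N * t - i) - 1))) * this
      · simp only [indicator_of_notMem ht, zero_mul]
    simp only [h1]
    have hle : (i : ℝ) / N ≤ ((i : ℝ) + 1) / N := by gcongr; linarith
    rw [integral_indicator measurableSet_Ioc, ← intervalIntegral.integral_of_le hle,
      intervalIntegral.integral_const_mul,
      intervalIntegral.integral_comp_mul_sub
        (fun u => legendre j (2 * u - 1) * legendre j' (2 * u - 1)) hN'.ne',
      mul_div_cancel₀ _ hN'.ne', mul_div_cancel₀ _ hN'.ne', sub_self, add_sub_cancel_left,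
      integral_legendre_mul]
    by_cases hj : j = j'
    · subst hj
      have h0 : 0 ≤ 2 * (j : ℝ) + 1 := by positivity
      simp only [and_self, if_true, Real.mul_self_sqrt h0, smul_eq_mul]
      field_simp
    · simp [hj]
  · have h1 : ∀ t, intervalLegendre N i j t * intervalLegendre N i' j' t = 0 := by
      intro t
      by_cases ht : t ∈ Ioc ((i : ℝ) / N) (((i : ℝ) + 1) / N)
      · rw [intervalLegendre, intervalLegendre, indicator_of_notMem
          (s := Ioc ((i' : ℝ) / N) (((i' : ℝ) + 1) / N)), mul_zero]
        exact fun ht' => hi (natCast_eq_of_mem_Ioc hN ht ht')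
      · rw [intervalLegendre, indicator_of_notMem ht, zero_mul]
    simp [h1, hi]

theorem integral_basisFun_mul (hN : 0 < N) (b b' : BasisIndex D N Q) :
    ∫ x, basisFun b x * basisFun b' x = if b = b' then 1 else 0 := by
  simp only [basisFun_eq_prod, ← Finset.prod_mul_distrib]
  rw [integral_fintype_prod_volume_eq_prod (f := fun d t =>
    intervalLegendre N (b.1 d) (b.2.1 d) t * intervalLegendre N (b'.1 d) (b'.2.1 d) t)]
  simp only [integral_intervalLegendre_mul hN]
  split_ifs with h
  · subst h
    simp
  · have : ∃ d, ¬ (((b.1 d : ℕ) = b'.1 d) ∧ ((b.2.1 d : ℕ) = b'.2.1 d)) := by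
      by_contra hall
      push Not at hall
      refine h (Prod.ext (funext fun d => Fin.ext (hall d).1)
        (Subtype.ext (funext fun d => Fin.ext (hall d).2)))
    obtain ⟨d, hd⟩ := this
    exact Finset.prod_eq_zero (Finset.mem_univ d) (if_neg hd)

theorem measurableSet_gridCube (i : Fin D → Fin N) : MeasurableSet (gridCube i) := by
  have : gridCube i = Set.pi univ fun d =>
      Ioc (((i d : ℕ) : ℝ) / N) ((((i d : ℕ) : ℝ) + 1) / N) := by
    ext x
    simp [gridCube]
  rw [this]
  exact MeasurableSet.univ_pi fun d => measurableSet_Ioc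

theorem measurable_basisFun (b : BasisIndex D N Q) : Measurable (basisFun b) := by
  refine Measurable.indicator (Continuous.measurable ?_) (measurableSet_gridCube _)
  have := continuous_legendre
  fun_prop

theorem gridCube_subset_unitCube (hN : 0 < N) (i : Fin D → Fin N) :
    gridCube i ⊆ unitCube D := by
  have hN' : (0 : ℝ) < N := Nat.cast_pos.2 hN
  intro x hx
  refine ⟨fun d => ?_, fun d => ?_⟩
  · exact (by positivity : (0 : ℝ) ≤ ((i d : ℕ) : ℝ) / N).trans (hx d).1.le
  · refine (hx d).2.trans ?_
    rw [Pi.one_apply, div_le_one hN']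
    exact_mod_cast (i d).2

theorem basisFun_eq_zero_of_notMem (hN : 0 < N) (b : BasisIndex D N Q) {x : Fin D → ℝ}
    (hx : x ∉ unitCube D) : basisFun b x = 0 :=
  indicator_of_notMem (fun h => hx (gridCube_subset_unitCube hN _ h)) _

theorem gridCube_eq_of_mem (hN : 0 < N) {i i' : Fin D → Fin N} {x : Fin D → ℝ}
    (h : x ∈ gridCube i) (h' : x ∈ gridCube i') : i = i' :=
  funext fun d => Fin.ext (natCast_eq_of_mem_Ioc hN (h d) (h' d))

theorem mul_sub_mem_Icc_of_mem_gridCube (hN : 0 < N) {i : Fin D → Fin N} {x : Fin D → ℝ}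
    (h : x ∈ gridCube i) (d : Fin D) : N * x d - ((i d : ℕ) : ℝ) ∈ Icc (0 : ℝ) 1 := by
  have hN' : (0 : ℝ) < N := Nat.cast_pos.2 hN
  have h1 := (div_lt_iff₀ hN').1 (h d).1
  have h2 := (le_div_iff₀ hN').1 (h d).2
  constructor <;> nlinarith

theorem card_multiIndex_le :
    Fintype.card {j : Fin D → Fin (Q + 1) // ∑ d, (j d : ℕ) ≤ Q} ≤ (D + Q).choose D := by
  -- a slack variable turns `∑ j_d ≤ Q` into an equality
  have hinj : Function.Injective (fun j : {j : Fin D → Fin (Q + 1) // ∑ d, (j d : ℕ) ≤ Q} =>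
      (⟨Fin.cons (Q - ∑ d, (j.1 d : ℕ)) fun d => (j.1 d : ℕ), by
        rw [Fin.sum_univ_succ]
        simp only [Fin.cons_zero, Fin.cons_succ]
        have := j.2
        omega⟩ : {P : Fin (D + 1) → ℕ // ∑ i, P i = Q})) := by
    intro j j' h
    have h1 := congrArg Subtype.val h
    refine Subtype.ext (funext fun d => Fin.ext ?_)
    have h2 := congrFun h1 d.succ
    simpa using h2
  have hc := Fintype.card_le_of_injective _
    ((Sym.equivNatSumOfFintype (Fin (D + 1)) Q).symm.injective.comp hinj)
  rw [Sym.card_sym_eq_choose, Fintype.card_fin] at hc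
  rw [show D + 1 + Q - 1 = D + Q by omega] at hc
  exact hc.trans_eq (Nat.choose_symm_of_eq_add (by omega))

theorem card_basisIndex_le : Fintype.card (BasisIndex D N Q) ≤ N ^ D * (D + Q).choose D := by
  rw [Fintype.card_prod, Fintype.card_fun, Fintype.card_fin, Fintype.card_fin]
  exact Nat.mul_le_mul_left _ card_multiIndex_le

theorem sq_basisFun_le (hN : 0 < N) (b : BasisIndex D N Q) (x : Fin D → ℝ) :
    basisFun b x ^ 2 ≤ N ^ D * Real.exp (2 * Q) := by
  by_cases hx : x ∈ gridCube b.1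
  · rw [basisFun_eq_prod, ← Finset.prod_pow]
    have h1 : ∀ d, intervalLegendre N (b.1 d) (b.2.1 d) (x d) ^ 2 ≤
        N * Real.exp (2 * (b.2.1 d : ℕ)) := by
      intro d
      have hu := mul_sub_mem_Icc_of_mem_gridCube hN hx d
      rw [intervalLegendre, indicator_of_mem (show x d ∈ Ioc _ _ from hx d), mul_pow, mul_pow,
        Real.sq_sqrt (Nat.cast_nonneg N), Real.sq_sqrt (by positivity)]
      have h2 := legendre_sq_le_one (b.2.1 d : ℕ) hu
      have h3 := Real.add_one_le_exp (2 * ((b.2.1 d : ℕ) : ℝ))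
      refine mul_le_mul_of_nonneg_left ?_ (Nat.cast_nonneg N)
      calc _ ≤ (2 * ((b.2.1 d : ℕ) : ℝ) + 1) * 1 := mul_le_mul_of_nonneg_left h2 (by positivity)
        _ ≤ _ := by linarith
    refine (Finset.prod_le_prod (fun d _ => sq_nonneg _) fun d _ => h1 d).trans ?_
    rw [Finset.prod_mul_distrib, Finset.prod_const, Finset.card_univ, Fintype.card_fin,
      ← Real.exp_sum, ← Finset.mul_sum]
    refine mul_le_mul_of_nonneg_left (Real.exp_le_exp.2 ?_) (by positivity)
    have := b.2.2
    have h4 : ∑ d, ((b.2.1 d : ℕ) : ℝ) ≤ Q := by exact_mod_cast this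
    linarith
  · rw [basisFun, indicator_of_notMem hx, zero_pow two_ne_zero]
    positivity

/-- At every point, only the basis functions of one grid cube are active. -/
theorem sum_sq_basisFun_le (hN : 0 < N) (x : Fin D → ℝ) :
    ∑ b : BasisIndex D N Q, basisFun b x ^ 2 ≤
      N ^ D * (D + Q).choose D * Real.exp (2 * Q) := by
  rw [Fintype.sum_prod_type]
  have hbd : ∀ i : Fin D → Fin N,
      ∑ j : {j : Fin D → Fin (Q + 1) // ∑ d, (j d : ℕ) ≤ Q},
        basisFun ((i, j) : BasisIndex D N Q) x ^ 2 ≤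
        N ^ D * (D + Q).choose D * Real.exp (2 * Q) := by
    intro i
    refine (Finset.sum_le_sum fun j _ => sq_basisFun_le hN (i, j) x).trans ?_
    rw [Finset.sum_const, Finset.card_univ, nsmul_eq_mul, mul_right_comm, mul_comm]
    refine mul_le_mul_of_nonneg_left ?_ (by positivity)
    exact_mod_cast card_multiIndex_le
  by_cases hx : ∃ i : Fin D → Fin N, x ∈ gridCube i
  · obtain ⟨i, hi⟩ := hx
    rw [Finset.sum_eq_single i]
    · exact hbd i
    · intro i' _ hne
      refine Finset.sum_eq_zero fun j _ => ?_
      rw [basisFun, indicator_of_notMem fun h => hne (gridCube_eq_of_mem hN h hi)]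
      simp
    · simp
  · push Not at hx
    rw [Finset.sum_eq_zero fun i _ => Finset.sum_eq_zero fun j _ => ?_]
    · positivity
    · rw [basisFun, indicator_of_notMem (hx i)]
      simp

end Basis

/-! ### The law of the sample -/

section Law

open Matrix

variable {D N Q K : ℕ} {f : (Fin D → ℝ) → ℝ}

theorem isCompact_unitCube (D : ℕ) : IsCompact (unitCube D) := isCompact_Icc

theorem measurableSet_unitCube (D : ℕ) : MeasurableSet (unitCube D) := measurableSet_Icc

theorem nonempty_unitCube (D : ℕ) : (unitCube D).Nonempty := ⟨0, le_rfl, zero_le_one⟩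

theorem lowerBd_le (hf : ContinuousOn f (unitCube D)) {x : Fin D → ℝ} (hx : x ∈ unitCube D) :
    lowerBd f ≤ f x :=
  csInf_le ((isCompact_unitCube D).image_of_continuousOn hf).bddBelow (mem_image_of_mem f hx)

theorem le_upperBd (hf : ContinuousOn f (unitCube D)) {x : Fin D → ℝ} (hx : x ∈ unitCube D) :
    f x ≤ upperBd f :=
  le_csSup ((isCompact_unitCube D).image_of_continuousOn hf).bddAbove (mem_image_of_mem f hx)

theorem lowerBd_pos (hf : ContinuousOn f (unitCube D)) (hfpos : ∀ x ∈ unitCube D, 0 < f x) :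
    0 < lowerBd f := by
  obtain ⟨x, hx, h⟩ := ((isCompact_unitCube D).image_of_continuousOn hf).sInf_mem
    ((nonempty_unitCube D).image f)
  rw [lowerBd, ← h]
  exact hfpos x hx

theorem lowerBd_le_upperBd (hf : ContinuousOn f (unitCube D)) : lowerBd f ≤ upperBd f := by
  obtain ⟨x, hx⟩ := nonempty_unitCube D
  exact (lowerBd_le hf hx).trans (le_upperBd hf hx)

theorem measurable_indicator_unitCube (hf : ContinuousOn f (unitCube D)) :
    Measurable ((unitCube D).indicator f) := by
  classical
  rw [← piecewise_eq_indicator]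
  exact hf.measurable_piecewise continuousOn_const (measurableSet_unitCube D)

theorem isProbabilityMeasure_cubeLaw (hf : ContinuousOn f (unitCube D))
    (hfpos : ∀ x ∈ unitCube D, 0 < f x) (hf1 : ∫ x in unitCube D, f x = 1) :
    IsProbabilityMeasure (cubeLaw f) := by
  refine ⟨?_⟩
  have hi : IntegrableOn f (unitCube D) := hf.integrableOn_compact (isCompact_unitCube D)
  have h0 : ∀ x, 0 ≤ (unitCube D).indicator f x :=
    fun x => indicator_nonneg (fun y hy => (hfpos y hy).le) x
  rw [cubeLaw, withDensity_apply _ MeasurableSet.univ, Measure.restrict_univ,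
    ← ofReal_integral_eq_lintegral_ofReal
      ((integrable_indicator_iff (measurableSet_unitCube D)).2 hi) (ae_of_all _ h0),
    integral_indicator (measurableSet_unitCube D), hf1, ENNReal.ofReal_one]

theorem cubeLaw_restrict (f : (Fin D → ℝ) → ℝ) :
    (cubeLaw f).restrict (unitCube D) = cubeLaw f := by
  rw [cubeLaw, restrict_withDensity (measurableSet_unitCube D)]
  have : (fun x => ENNReal.ofReal ((unitCube D).indicator f x)) =
      (unitCube D).indicator fun x => ENNReal.ofReal (f x) := by
    funext x
    by_cases hx : x ∈ unitCube D <;> simp [hx]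
  rw [this, withDensity_indicator (measurableSet_unitCube D),
    withDensity_indicator (measurableSet_unitCube D),
    Measure.restrict_restrict (measurableSet_unitCube D), inter_self]

theorem ae_mem_unitCube (f : (Fin D → ℝ) → ℝ) : ∀ᵐ x ∂cubeLaw f, x ∈ unitCube D := by
  rw [← cubeLaw_restrict]
  exact ae_restrict_mem (measurableSet_unitCube D)

theorem cubeLaw_absolutelyContinuous (f : (Fin D → ℝ) → ℝ) : cubeLaw f ≪ volume :=
  withDensity_absolutelyContinuous _ _

theorem integral_cubeLaw (hf : ContinuousOn f (unitCube D))
    (hfpos : ∀ x ∈ unitCube D, 0 < f x) (g : (Fin D → ℝ) → ℝ) :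
    ∫ x, g x ∂cubeLaw f = ∫ x in unitCube D, f x * g x := by
  have h0 : ∀ x, 0 ≤ (unitCube D).indicator f x :=
    fun x => indicator_nonneg (fun y hy => (hfpos y hy).le) x
  rw [cubeLaw, integral_withDensity_eq_integral_toReal_smul
    (measurable_indicator_unitCube hf).ennreal_ofReal (by simp),
    ← integral_indicator (measurableSet_unitCube D)]
  refine integral_congr_ae (ae_of_all _ fun x => ?_)
  simp only [ENNReal.toReal_ofReal (h0 x), smul_eq_mul]
  by_cases hx : x ∈ unitCube D <;> simp [hx]

theorem isProbabilityMeasure_restrict_unitCube (D : ℕ) :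
    IsProbabilityMeasure ((volume : Measure (Fin D → ℝ)).restrict (unitCube D)) := by
  refine ⟨?_⟩
  rw [Measure.restrict_apply_univ, unitCube, Real.volume_Icc_pi]
  simp

variable (e : Fin K ≃ BasisIndex D N Q)

theorem measurable_basisVec : Measurable fun x k => basisFun (e k) x :=
  measurable_pi_lambda _ fun k => measurable_basisFun (e k)

theorem basisVec_dotProduct_self_le (hN : 0 < N) (x : Fin D → ℝ) :
    (fun k => basisFun (e k) x) ⬝ᵥ (fun k => basisFun (e k) x) ≤
      N ^ D * (D + Q).choose D * Real.exp (2 * Q) := by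
  refine le_trans (le_of_eq ?_) (sum_sq_basisFun_le (Q := Q) hN x)
  rw [← Equiv.sum_comp e]
  simp [dotProduct, sq]

theorem integral_sq_dotProduct_basisVec (hN : 0 < N) (v : Fin K → ℝ) :
    ∫ x in unitCube D, (v ⬝ᵥ fun k => basisFun (e k) x) ^ 2 = v ⬝ᵥ v := by
  have := isProbabilityMeasure_restrict_unitCube D
  set ν := (volume : Measure (Fin D → ℝ)).restrict (unitCube D) with hν
  have hηk : ∀ k, MemLp (basisFun (e k)) 2 ν := fun k => by
    simpa using memLp_dotProduct (μ := ν) (measurable_basisVec e)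
      (basisVec_dotProduct_self_le e hN) (Pi.single k 1)
  have h1 : ∀ x, (v ⬝ᵥ fun k => basisFun (e k) x) ^ 2 =
      ∑ k, ∑ l, v k * v l * (basisFun (e k) x * basisFun (e l) x) := fun x => by
    rw [sq, dotProduct, Finset.sum_mul_sum]
    exact Finset.sum_congr rfl fun k _ => Finset.sum_congr rfl fun l _ => by ring
  have h2 : ∀ k l, Integrable (fun x => v k * v l * (basisFun (e k) x * basisFun (e l) x)) ν :=
    fun k l => (integrable_fun_mul (hηk k) (hηk l)).const_mul _
  have h3 : ∀ k l, ∫ x, basisFun (e k) x * basisFun (e l) x ∂ν = if k = l then 1 else 0 := by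
    intro k l
    rw [hν, setIntegral_eq_integral_of_forall_compl_eq_zero fun x hx => by
      rw [basisFun_eq_zero_of_notMem hN _ hx, zero_mul], integral_basisFun_mul hN]
    simp
  simp only [h1]
  rw [integral_finsetSum _ fun k _ => integrable_finsetSum _ fun l _ => h2 k l]
  refine Finset.sum_congr rfl fun k _ => ?_
  rw [integral_finsetSum _ fun l _ => h2 k l]
  simp only [integral_const_mul, h3]
  simp

theorem integral_sq_dotProduct_bounds (hf : ContinuousOn f (unitCube D))
    (hfpos : ∀ x ∈ unitCube D, 0 < f x) (hN : 0 < N) (v : Fin K → ℝ) :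
    lowerBd f * (v ⬝ᵥ v) ≤ ∫ x, (v ⬝ᵥ fun k => basisFun (e k) x) ^ 2 ∂cubeLaw f ∧
    ∫ x, (v ⬝ᵥ fun k => basisFun (e k) x) ^ 2 ∂cubeLaw f ≤ upperBd f * (v ⬝ᵥ v) := by
  have := isProbabilityMeasure_restrict_unitCube D
  have hi : IntegrableOn (fun x => (v ⬝ᵥ fun k => basisFun (e k) x) ^ 2) (unitCube D) :=
    integrable_sq_dotProduct (measurable_basisVec e) (basisVec_dotProduct_self_le e hN) v
  have hfi : IntegrableOn (fun x => f x * (v ⬝ᵥ fun k => basisFun (e k) x) ^ 2) (unitCube D) :=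
    hi.continuousOn_mul hf (isCompact_unitCube D)
  rw [integral_cubeLaw hf hfpos, ← integral_sq_dotProduct_basisVec e hN v,
    ← integral_const_mul, ← integral_const_mul]
  exact ⟨setIntegral_mono_on (hi.const_mul _) hfi (measurableSet_unitCube D) fun x hx =>
      mul_le_mul_of_nonneg_right (lowerBd_le hf hx) (sq_nonneg _),
    setIntegral_mono_on hfi (hi.const_mul _) (measurableSet_unitCube D) fun x hx =>
      mul_le_mul_of_nonneg_right (le_upperBd hf hx) (sq_nonneg _)⟩

end Law

end SVDRegression

/-! ### Taylor approximation on the grid cubes -/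

namespace SVDRegression

section Taylor

open scoped Pointwise

/-- Taylor's theorem on `[0,1]`, with the remainder expressed by the increment of the derivative
of highest order. -/
theorem abs_sub_taylor_le {g : ℝ → ℝ} {Q : ℕ} (hg : ContDiffOn ℝ Q g (Icc 0 1)) {M : ℝ}
    (hM : ∀ t ∈ Icc (0 : ℝ) 1, |iteratedDerivWithin Q g (Icc 0 1) t -
      iteratedDerivWithin Q g (Icc 0 1) 0| ≤ M) :
    |g 1 - ∑ k ∈ Finset.range (Q + 1),
      ((k.factorial : ℝ)⁻¹) * iteratedDerivWithin k g (Icc 0 1) 0| ≤ M / Q.factorial := by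
  cases Q with
  | zero => simpa using hM 1 ⟨zero_le_one, le_rfl⟩
  | succ n =>
    have hu : uIcc (0 : ℝ) 1 = Icc 0 1 := uIcc_of_le zero_le_one
    have huo : uIoo (0 : ℝ) 1 = Ioo 0 1 := uIoo_of_le zero_le_one
    have h1 : ContDiffOn ℝ n g (uIcc 0 1) := by
      rw [hu]
      exact hg.of_le (by exact_mod_cast Nat.le_succ n)
    have h2 : DifferentiableOn ℝ (iteratedDerivWithin n g (uIcc 0 1)) (uIoo 0 1) := by
      rw [hu, huo]
      exact (hg.differentiableOn_iteratedDerivWithin (by exact_mod_cast Nat.lt_succ_self n)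
        (uniqueDiffOn_Icc zero_lt_one)).mono Ioo_subset_Icc_self
    obtain ⟨t, ht, h⟩ := taylor_mean_remainder_lagrange zero_ne_one h1 h2
    rw [huo] at ht
    rw [hu, taylor_within_apply] at h
    simp only [sub_zero, one_pow, mul_one, smul_eq_mul] at h
    rw [Finset.sum_range_succ, ← sub_sub, h]
    have h3 := hM t (Ioo_subset_Icc_self ht)
    have hf : (0 : ℝ) < ((n + 1).factorial : ℝ) := by positivity
    rw [show iteratedDerivWithin (n + 1) g (Icc 0 1) t / ((n + 1).factorial : ℝ) -
      ((n + 1).factorial : ℝ)⁻¹ * iteratedDerivWithin (n + 1) g (Icc 0 1) 0 =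
      (iteratedDerivWithin (n + 1) g (Icc 0 1) t - iteratedDerivWithin (n + 1) g (Icc 0 1) 0) /
        ((n + 1).factorial : ℝ) by ring, abs_div, abs_of_pos hf]
    gcongr

variable {D Q : ℕ} {y : (Fin D → ℝ) → ℝ}

theorem convex_unitCube (D : ℕ) : Convex ℝ (unitCube D) := convex_Icc _ _

/-- The derivatives along a segment in the unit cube. The map `t ↦ x₀ + t h` is decomposed into a
linear map and a translation, for each of which there is a chain rule for iterated derivatives. -/
theorem iteratedDerivWithin_segment (hy : ContDiffOn ℝ Q y (unitCube D)) {x₀ h : Fin D → ℝ}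
    (hx₀ : x₀ ∈ unitCube D) (hx : x₀ + h ∈ unitCube D) {k : ℕ} (hk : k ≤ Q) {t : ℝ}
    (ht : t ∈ Icc (0 : ℝ) 1) :
    iteratedDerivWithin k (fun t : ℝ => y (x₀ + t • h)) (Icc 0 1) t =
      iteratedFDerivWithin ℝ k y (unitCube D) (x₀ + t • h) (fun _ => h) := by
  set s' : Set (Fin D → ℝ) := (fun z => x₀ + z) ⁻¹' unitCube D with hs'
  have hs'u : UniqueDiffOn ℝ s' := by
    rw [hs', unitCube, preimage_const_add_Icc, ← pi_univ_Icc]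
    exact UniqueDiffOn.univ_pi fun d => uniqueDiffOn_Icc (by simp)
  have hvadd : x₀ +ᵥ s' = unitCube D := by
    ext z
    rw [mem_vadd_set_iff_neg_vadd_mem]
    simp [hs']
  have hyk : ContDiffOn ℝ k y (unitCube D) := hy.of_le (by exact_mod_cast hk)
  have hy' : ContDiffOn ℝ k (fun z => y (x₀ + z)) s' :=
    hyk.comp (contDiff_const.add contDiff_id).contDiffOn fun z hz => hz
  set l : ℝ →L[ℝ] (Fin D → ℝ) := ContinuousLinearMap.toSpanSingleton ℝ h with hl
  have hlt : ∀ t : ℝ, l t = t • h := fun t => by simp [hl]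
  have hsub : Icc (0 : ℝ) 1 ⊆ l ⁻¹' s' := by
    intro t ht
    rw [mem_preimage, hlt, hs', mem_preimage]
    have h1 := (convex_unitCube D).add_smul_sub_mem hx₀ hx ht
    rwa [add_sub_cancel_left] at h1
  have hconv : Convex ℝ (l ⁻¹' s') := by
    refine Convex.is_linear_preimage ?_ l.isLinear
    exact (convex_unitCube D).translate_preimage_right x₀
  have hlu : UniqueDiffOn ℝ (l ⁻¹' s') := by
    refine uniqueDiffOn_convex hconv (Nonempty.mono (interior_mono hsub) ?_)
    rw [interior_Icc]
    exact nonempty_Ioo.2 zero_lt_one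
  have hcomp : ContDiffOn ℝ k ((fun z => y (x₀ + z)) ∘ l) (l ⁻¹' s') :=
    hy'.comp l.contDiff.contDiffOn fun t ht => ht
  have h1 := iteratedFDerivWithin_subset hsub (uniqueDiffOn_Icc zero_lt_one) hlu hcomp ht
  have h2 := l.iteratedFDerivWithin_comp_right hy' hs'u hlu (hsub ht) le_rfl
  have h3 := iteratedFDerivWithin_comp_add_left (𝕜 := ℝ) (f := y) (s := s') k x₀ (l t)
  rw [hvadd] at h3
  have h4 : (fun t : ℝ => y (x₀ + t • h)) = (fun z => y (x₀ + z)) ∘ l := by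
    funext t
    simp [hlt]
  rw [iteratedDerivWithin_eq_iteratedFDerivWithin, h4, h1, h2, h3]
  simp [hlt]

/-- The expansion of a multilinear form on the diagonal in coordinates. -/
theorem multilinear_diag_eq_sum {k : ℕ}
    (T : ContinuousMultilinearMap ℝ (fun _ : Fin k => Fin D → ℝ) ℝ) (h : Fin D → ℝ) :
    T (fun _ => h) = ∑ r : Fin k → Fin D, (∏ m, h (r m)) * T fun m => Pi.single (r m) 1 := by
  have h1 : (fun _ : Fin k => h) = fun _ => ∑ d, h d • (Pi.single d (1 : ℝ) : Fin D → ℝ) := by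
    funext _
    ext d
    simp [Finset.sum_apply, Pi.single_apply]
  rw [h1, T.map_sum]
  refine Finset.sum_congr rfl fun r _ => ?_
  rw [T.map_smul_univ, smul_eq_mul]

theorem norm_toLp_le {δ : ℝ} (hδ : 0 ≤ δ) {z : Fin D → ℝ} (hz : ∀ d, |z d| ≤ δ) :
    ‖WithLp.toLp 2 z‖ ≤ √D * δ := by
  rw [EuclideanSpace.norm_eq, ← Real.sqrt_sq hδ, ← Real.sqrt_mul (Nat.cast_nonneg D)]
  refine Real.sqrt_le_sqrt ?_
  refine (Finset.sum_le_sum (g := fun _ => δ ^ 2) fun d _ => ?_).trans_eq ?_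
  · rw [Real.norm_eq_abs]
    exact pow_le_pow_left₀ (abs_nonneg _) (hz d) 2
  · simp

/-- The Taylor polynomial of degree `Q` of a `(Q + γ, C)`-smooth function. -/
theorem abs_sub_taylor_unitCube_le {γ C δ : ℝ} (hγ : 0 < γ) (hy : IsHolderSmooth Q γ C y)
    {x₀ h : Fin D → ℝ} (hx₀ : x₀ ∈ unitCube D) (hx : x₀ + h ∈ unitCube D) (hδ : 0 ≤ δ)
    (hh : ∀ d, |h d| ≤ δ) :
    |y (x₀ + h) - ∑ k ∈ Finset.range (Q + 1), ∑ r : Fin k → Fin D, (∏ m, h (r m)) *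
        (((k.factorial : ℝ)⁻¹) *
          iteratedFDerivWithin ℝ k y (unitCube D) x₀ fun m => Pi.single (r m) 1)| ≤
      D ^ Q * δ ^ Q * (|C| * (√D * δ) ^ γ) / Q.factorial := by
  have hseg : ∀ t ∈ Icc (0 : ℝ) 1, x₀ + t • h ∈ unitCube D := fun t ht => by
    have h1 := (convex_unitCube D).add_smul_sub_mem hx₀ hx ht
    rwa [add_sub_cancel_left] at h1
  have hg : ContDiffOn ℝ Q (fun t : ℝ => y (x₀ + t • h)) (Icc 0 1) :=
    hy.1.comp (ContDiff.contDiffOn (by fun_prop)) hseg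
  have hmain := abs_sub_taylor_le hg (M := D ^ Q * δ ^ Q * (|C| * (√D * δ) ^ γ)) ?_
  · refine le_trans (le_of_eq ?_) hmain
    congr 1
    simp only [one_smul]
    congr 1
    refine Finset.sum_congr rfl fun k hk => ?_
    rw [iteratedDerivWithin_segment hy.1 hx₀ hx (Nat.lt_succ_iff.1 (Finset.mem_range.1 hk))
      ⟨le_rfl, zero_le_one⟩, multilinear_diag_eq_sum, zero_smul, add_zero, Finset.mul_sum]
    exact Finset.sum_congr rfl fun r _ => by ring
  · intro t ht
    rw [iteratedDerivWithin_segment hy.1 hx₀ hx le_rfl ht,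
      iteratedDerivWithin_segment hy.1 hx₀ hx le_rfl ⟨le_rfl, zero_le_one⟩, zero_smul, add_zero,
      multilinear_diag_eq_sum, multilinear_diag_eq_sum, ← Finset.sum_sub_distrib]
    refine (Finset.abs_sum_le_sum_abs _ _).trans ?_
    refine (Finset.sum_le_sum (g := fun _ => δ ^ Q * (|C| * (√D * δ) ^ γ)) fun r _ => ?_).trans_eq
      ?_
    · rw [← mul_sub, abs_mul, Finset.abs_prod]
      refine mul_le_mul ?_ ?_ (abs_nonneg _) (by positivity)
      · refine (Finset.prod_le_prod (fun m _ => abs_nonneg _) fun m _ => hh (r m)).trans_eq ?_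
        simp
      · refine (hy.2 r _ (hseg t ht) _ hx₀).trans ?_
        rw [add_sub_cancel_left]
        have h1 : ‖WithLp.toLp 2 (t • h)‖ ≤ √D * δ := by
          refine norm_toLp_le hδ fun d => ?_
          rw [Pi.smul_apply, smul_eq_mul, abs_mul, abs_of_nonneg ht.1]
          exact (mul_le_of_le_one_left (abs_nonneg _) ht.2).trans (hh d)
        refine mul_le_mul (le_abs_self C) ?_ (by positivity) (abs_nonneg _)
        exact Real.rpow_le_rpow (norm_nonneg _) h1 hγ.le
    · simp
      ring

/-- Monomials of total degree at most `Q` are combinations of tensor products of Legendre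
polynomials of total degree at most `Q`. -/
theorem prod_mem_span_legendre {k : ℕ} (hk : k ≤ Q) (r : Fin k → Fin D) :
    (fun u : Fin D → ℝ => ∏ m, u (r m)) ∈ Submodule.span ℝ (range
      fun (j : {j : Fin D → Fin (Q + 1) // ∑ d, (j d : ℕ) ≤ Q}) (u : Fin D → ℝ) =>
        ∏ d, legendre (j.1 d : ℕ) (2 * u d - 1)) := by
  set a : Fin D → ℕ := fun d => (Finset.univ.filter fun m => r m = d).card with ha
  have hasum : ∑ d, a d = k := by
    have := Finset.card_eq_sum_card_fiberwise (f := r) (s := Finset.univ) (t := Finset.univ)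
      (fun _ _ => Finset.mem_coe.2 (Finset.mem_univ _))
    rw [Finset.card_univ, Fintype.card_fin] at this
    exact this.symm
  have h1 : ∀ u : Fin D → ℝ, ∏ m, u (r m) = ∏ d, u d ^ a d := by
    intro u
    rw [← Finset.prod_fiberwise (g := r)]
    refine Finset.prod_congr rfl fun d _ => ?_
    rw [ha, ← Finset.prod_const]
    refine Finset.prod_congr rfl fun m hm => ?_
    rw [(Finset.mem_filter.1 hm).2]
  choose c hc using exists_pow_eq_sum_legendre
  have h2 : (fun u : Fin D → ℝ => ∏ m, u (r m)) =
      ∑ p ∈ Fintype.piFinset fun d => Finset.range (a d + 1), (∏ d, c (a d) (p d)) •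
        fun u : Fin D → ℝ => ∏ d, legendre (p d) (2 * u d - 1) := by
    funext u
    rw [h1]
    simp only [hc, Finset.prod_univ_sum, Finset.sum_apply, Pi.smul_apply, smul_eq_mul,
      Finset.prod_mul_distrib]
  rw [h2]
  refine Submodule.sum_mem _ fun p hp => Submodule.smul_mem _ _ (Submodule.subset_span ?_)
  have hpa : ∀ d, p d ≤ a d := fun d =>
    Nat.lt_succ_iff.1 (Finset.mem_range.1 (Fintype.mem_piFinset.1 hp d))
  have hpQ : ∑ d, p d ≤ Q := (Finset.sum_le_sum fun d _ => hpa d).trans (hasum.trans_le hk)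
  have hpd : ∀ d, p d < Q + 1 := fun d =>
    Nat.lt_succ_iff.2 ((Finset.single_le_sum (fun _ _ => Nat.zero_le _)
      (Finset.mem_univ d)).trans hpQ)
  exact ⟨⟨fun d => ⟨p d, hpd d⟩, hpQ⟩, rfl⟩

variable {N : ℕ}

/-- On each grid cube, the basis approximates a `(Q + γ, C)`-smooth function at least as well as
the Taylor polynomial at the lower corner of the cube. -/
theorem exists_approx_gridCube {γ C : ℝ} (hγ : 0 < γ) (hy : IsHolderSmooth Q γ C y) (hN : 0 < N)
    (i : Fin D → Fin N) :
    ∃ β : {j : Fin D → Fin (Q + 1) // ∑ d, (j d : ℕ) ≤ Q} → ℝ, ∀ x ∈ gridCube i,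
      |y x - ∑ j, β j * basisFun ((i, j) : BasisIndex D N Q) x| ≤
        D ^ Q * (1 / N) ^ Q * (|C| * (√D * (1 / N)) ^ γ) / Q.factorial := by
  have hN' : (0 : ℝ) < N := Nat.cast_pos.2 hN
  set x₀ : Fin D → ℝ := fun d => ((i d : ℕ) : ℝ) / N with hx₀
  have hx₀c : x₀ ∈ unitCube D := by
    refine ⟨fun d => ?_, fun d => ?_⟩
    · exact (by positivity : (0 : ℝ) ≤ ((i d : ℕ) : ℝ) / N)
    · rw [hx₀, Pi.one_apply, div_le_one hN']
      exact_mod_cast (i d).2.le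
  set T : (Fin D → ℝ) → ℝ := fun u => ∑ k ∈ Finset.range (Q + 1), ∑ r : Fin k → Fin D,
    (∏ m, ((N : ℝ)⁻¹ * u (r m))) * (((k.factorial : ℝ)⁻¹) *
      iteratedFDerivWithin ℝ k y (unitCube D) x₀ fun m => Pi.single (r m) 1) with hT
  have hTmem : T ∈ Submodule.span ℝ (range
      fun (j : {j : Fin D → Fin (Q + 1) // ∑ d, (j d : ℕ) ≤ Q}) (u : Fin D → ℝ) =>
        ∏ d, legendre (j.1 d : ℕ) (2 * u d - 1)) := by
    have h1 : T = ∑ k ∈ Finset.range (Q + 1), ∑ r : Fin k → Fin D,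
        ((N : ℝ)⁻¹ ^ k * (((k.factorial : ℝ)⁻¹) *
          iteratedFDerivWithin ℝ k y (unitCube D) x₀ fun m => Pi.single (r m) 1)) •
        fun u : Fin D → ℝ => ∏ m, u (r m) := by
      funext u
      simp only [hT, Finset.sum_apply, Pi.smul_apply, smul_eq_mul, Finset.prod_mul_distrib,
        Finset.prod_const, Finset.card_univ, Fintype.card_fin]
      exact Finset.sum_congr rfl fun k _ => Finset.sum_congr rfl fun r _ => by ring
    rw [h1]
    exact Submodule.sum_mem _ fun k hk => Submodule.sum_mem _ fun r _ =>
      Submodule.smul_mem _ _ (prod_mem_span_legendre (Nat.lt_succ_iff.1 (Finset.mem_range.1 hk)) r)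
  obtain ⟨c, hc⟩ := (Submodule.mem_span_range_iff_exists_fun ℝ).1 hTmem
  -- the normalization of the basis functions
  set w : {j : Fin D → Fin (Q + 1) // ∑ d, (j d : ℕ) ≤ Q} → ℝ := fun j =>
    (N : ℝ) ^ ((D : ℝ) / 2) * ∏ d, √(2 * ((j.1 d : ℕ) : ℝ) + 1) with hw
  have hw0 : ∀ j, w j ≠ 0 := fun j => by
    refine mul_ne_zero (Real.rpow_pos_of_pos hN' _).ne' (Finset.prod_ne_zero_iff.2 fun d _ => ?_)
    exact (Real.sqrt_pos.2 (by positivity)).ne'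
  refine ⟨fun j => c j / w j, fun x hx => ?_⟩
  have hsum : ∑ j, c j / w j * basisFun ((i, j) : BasisIndex D N Q) x =
      T fun d => N * x d - ((i d : ℕ) : ℝ) := by
    rw [← hc, Finset.sum_apply]
    refine Finset.sum_congr rfl fun j _ => ?_
    rw [basisFun, indicator_of_mem hx, Finset.prod_mul_distrib, Pi.smul_apply, smul_eq_mul,
      ← mul_assoc, ← mul_assoc, mul_assoc (c j / w j), div_mul_cancel₀ _ (hw0 j)]
  have hu : ∀ d, (N : ℝ)⁻¹ * (N * x d - ((i d : ℕ) : ℝ)) = (x - x₀) d := fun d => by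
    rw [Pi.sub_apply, hx₀]
    field_simp
  have hxc : x₀ + (x - x₀) ∈ unitCube D := by
    rw [add_sub_cancel]
    exact gridCube_subset_unitCube hN i hx
  have hmain := abs_sub_taylor_unitCube_le hγ hy hx₀c hxc (δ := 1 / N) (by positivity) ?_
  · rw [hsum]
    simp only [hT, hu]
    rwa [add_sub_cancel] at hmain
  · intro d
    have h1 := mul_sub_mem_Icc_of_mem_gridCube hN hx d
    rw [← hu, abs_of_nonneg (mul_nonneg (by positivity) h1.1), one_div]
    exact mul_le_of_le_one_right (by positivity) h1.2

theorem exists_mem_gridCube (hN : 0 < N) {x : Fin D → ℝ} (hx : x ∈ unitCube D)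
    (hx0 : ∀ d, x d ≠ 0) : ∃ i : Fin D → Fin N, x ∈ gridCube i := by
  have hN' : (0 : ℝ) < N := Nat.cast_pos.2 hN
  have h : ∀ d, ∃ i : Fin N, ((i : ℕ) : ℝ) / N < x d ∧ x d ≤ (((i : ℕ) : ℝ) + 1) / N := by
    intro d
    have hpos : 0 < x d := lt_of_le_of_ne (hx.1 d) (hx0 d).symm
    have hNx : 0 < N * x d := by positivity
    have hle : N * x d ≤ N := mul_le_of_le_one_right hN'.le (hx.2 d)
    have hc1 : 0 < ⌈N * x d⌉₊ := Nat.ceil_pos.2 hNx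
    have hc2 : ⌈N * x d⌉₊ ≤ N := Nat.ceil_le.2 hle
    refine ⟨⟨⌈N * x d⌉₊ - 1, by omega⟩, ?_, ?_⟩
    · rw [div_lt_iff₀ hN', Nat.cast_pred hc1]
      have := Nat.ceil_lt_add_one hNx.le
      linarith
    · rw [le_div_iff₀ hN', Nat.cast_pred hc1, sub_add_cancel, mul_comm]
      exact Nat.le_ceil _
  choose i hi using h
  exact ⟨i, hi⟩

theorem ae_ne_zero_coord (D : ℕ) : ∀ᵐ x : Fin D → ℝ, ∀ d, x d ≠ 0 := by
  rw [ae_all_iff]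
  intro d
  exact Measure.ae_eval_ne (fun _ : Fin D => (volume : Measure ℝ)) d 0

/-- The approximation error of the whole basis. -/
theorem exists_approx {K : ℕ} (e : Fin K ≃ BasisIndex D N Q) {γ C : ℝ} (hγ : 0 < γ)
    (hy : IsHolderSmooth Q γ C y) (hN : 0 < N) (f : (Fin D → ℝ) → ℝ) :
    ∃ β : Fin K → ℝ, ∀ᵐ x ∂cubeLaw f,
      |y x - estimate e β x| ≤
        D ^ Q * (1 / N) ^ Q * (|C| * (√D * (1 / N)) ^ γ) / Q.factorial := by
  choose β hβ using exists_approx_gridCube (y := y) hγ hy hN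
  refine ⟨fun k => β (e k).1 (e k).2, ?_⟩
  filter_upwards [ae_mem_unitCube f,
    (cubeLaw_absolutelyContinuous f).ae_le (ae_ne_zero_coord D)] with x hx hx0
  obtain ⟨i, hi⟩ := exists_mem_gridCube hN hx hx0
  have h1 : estimate e (fun k => β (e k).1 (e k).2) x =
      ∑ j, β i j * basisFun ((i, j) : BasisIndex D N Q) x := by
    rw [estimate, Equiv.sum_comp e (fun b => β b.1 b.2 * basisFun b x), Fintype.sum_prod_type]
    rw [Finset.sum_eq_single i]
    · intro i' _ hne
      refine Finset.sum_eq_zero fun j _ => ?_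
      rw [basisFun, indicator_of_notMem fun h => hne (gridCube_eq_of_mem hN h hi), mul_zero]
    · simp
  rw [h1]
  exact hβ i x hi

end Taylor

end SVDRegression

/-! ### The error bound -/

namespace SVDRegression

section ErrorBound

open Matrix

variable {D N Q K L : ℕ} {γ C ε c₀ : ℝ} {f y : (Fin D → ℝ) → ℝ}

theorem estimate_eq_dotProduct (e : Fin K ≃ BasisIndex D N Q) (α : Fin K → ℝ) (x : Fin D → ℝ) :
    estimate e α x = α ⬝ᵥ fun k => basisFun (e k) x := rfl

theorem sqError_eq (f y : (Fin D → ℝ) → ℝ) (e : Fin K ≃ BasisIndex D N Q) (α : Fin K → ℝ) :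
    sqError f y e α = ∫ x, (y x - α ⬝ᵥ fun k => basisFun (e k) x) ^ 2 ∂cubeLaw f := by
  rw [sqError, cubeLaw_restrict]
  simp only [sq_abs, estimate_eq_dotProduct]

theorem memLp_cubeLaw (hy : ContinuousOn y (unitCube D)) [IsProbabilityMeasure (cubeLaw f)] :
    MemLp y 2 (cubeLaw f) := by
  rw [← cubeLaw_restrict]
  refine (memLp_two_iff_integrable_sq
    (hy.aestronglyMeasurable (measurableSet_unitCube D))).2 ?_
  exact (hy.pow 2).integrableOn_compact (isCompact_unitCube D)

/-- The square of the bound for the approximation error of the basis. -/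
theorem sq_approx_bound (hD : 0 < D) (hN : 0 < N) :
    ((D : ℝ) ^ Q * (1 / (N : ℝ)) ^ Q * (|C| * (√D * (1 / N)) ^ γ) / Q.factorial) ^ 2 =
      1 / (N : ℝ) ^ (2 * (Q + γ)) *
        ((D : ℝ) ^ (2 * Q + γ) / (Q.factorial : ℝ) ^ 2 * C ^ 2) := by
  have hN' : (0 : ℝ) < N := Nat.cast_pos.2 hN
  have hD' : (0 : ℝ) < D := Nat.cast_pos.2 hD
  have h1 : ((√D * (1 / (N : ℝ))) ^ γ) ^ 2 = (D : ℝ) ^ γ / (N : ℝ) ^ (2 * γ) := by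
    rw [← Real.rpow_natCast, ← Real.rpow_mul (by positivity), mul_comm γ, Real.rpow_mul
      (by positivity), Real.rpow_natCast, mul_pow, Real.sq_sqrt hD'.le,
      Real.mul_rpow hD'.le (by positivity), one_div, inv_pow, Real.inv_rpow (by positivity),
      Real.rpow_mul hN'.le, div_eq_mul_inv]
    norm_num
  have h2 : (N : ℝ) ^ (2 * ((Q : ℝ) + γ)) = (N ^ Q) ^ 2 * (N : ℝ) ^ (2 * γ) := by
    rw [mul_add, Real.rpow_add hN', ← pow_mul, ← Real.rpow_natCast]
    push_cast
    ring_nf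
  have h3 : (D : ℝ) ^ (2 * (Q : ℝ) + γ) = (D ^ Q) ^ 2 * (D : ℝ) ^ γ := by
    rw [Real.rpow_add hD', ← pow_mul, ← Real.rpow_natCast]
    push_cast
    ring_nf
  rw [div_pow, mul_pow, mul_pow, mul_pow, sq_abs, h1, h2, h3, _root_.one_div_pow]
  have := Real.rpow_pos_of_pos hN' (2 * γ)
  field_simp

/-- The bound for the probability of truncation. The sample bound leaves a factor
`6 / ε` in the exponent to spare. If `c₀ N^{D+2(Q+γ)} ≤ 1`, then the sample bound is void, but the
right-hand side is at least one. -/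
theorem truncation_le (hf : ContinuousOn f (unitCube D)) (hfpos : ∀ x ∈ unitCube D, 0 < f x)
    (hε : 0 < ε) (hε1 : ε < 1) (hc₀ : 0 < c₀) (hN : 0 < N)
    (hL : sampleBound Q N γ ε c₀ f ≤ L) (hK : (K : ℝ) ≤ N ^ D * (D + Q).choose D) :
    min 1 (K * Real.exp (L * ((1 - ε) * lowerBd f / 2 /
      (N ^ D * (D + Q).choose D * Real.exp (2 * Q)) -
      lowerBd f / (2 * (N ^ D * (D + Q).choose D * Real.exp (2 * Q)))))) ≤
      1 / (N : ℝ) ^ (2 * (Q + γ)) * (((D + Q).choose D : ℝ) / c₀) := by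
  have hN' : (0 : ℝ) < N := Nat.cast_pos.2 hN
  have hN1 : (1 : ℝ) ≤ N := Nat.one_le_cast.2 hN
  have ha := lowerBd_pos hf hfpos
  have hab := lowerBd_le_upperBd hf
  set a := lowerBd f
  set b := upperBd f
  have hM1 : (1 : ℝ) ≤ (D + Q).choose D := Nat.one_le_cast.2 (Nat.choose_pos (by omega))
  set M : ℝ := ((D + Q).choose D : ℝ)
  set R : ℝ := N ^ D * M * Real.exp (2 * Q) with hR
  have hR0 : 0 < R := by positivity
  have hp := Real.rpow_pos_of_pos hN' (2 * ((Q : ℝ) + γ))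
  set p := (N : ℝ) ^ (2 * ((Q : ℝ) + γ))
  have hx : (N : ℝ) ^ ((D : ℝ) + 2 * (Q + γ)) = N ^ D * p := by
    rw [Real.rpow_add hN', Real.rpow_natCast]
  have hND : (1 : ℝ) ≤ (N : ℝ) ^ D := one_le_pow₀ hN1
  set x := c₀ * (N ^ D * p) with hxdef
  have hx0 : 0 < x := by positivity
  rcases le_or_gt x 1 with hx1 | hx1
  · refine (min_le_left _ _).trans ?_
    rw [one_div_mul_eq_div, div_div, le_div_iff₀ (by positivity), one_mul]
    have : c₀ * p ≤ x := by
      rw [hxdef]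
      exact mul_le_mul_of_nonneg_left (le_mul_of_one_le_left hp.le hND) hc₀.le
    linarith
  · refine (min_le_right _ _).trans ?_
    have hlog : 0 < Real.log x := Real.log_pos hx1
    have hexp : L * ((1 - ε) * a / 2 / R - a / (2 * R)) = -(L * (ε * a / (2 * R))) := by
      field_simp
      ring
    have hS : Real.log x ≤ L * (ε * a / (2 * R)) := by
      rw [sampleBound, hx] at hL
      have h1 : 12 * R / (ε ^ 2 * a) * Real.log x ≤ L := by
        refine le_trans (mul_le_mul_of_nonneg_right ?_ hlog.le) hL
        rw [div_le_div_iff₀ (by positivity) (by positivity)]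
        have hba : 1 ≤ b / a := (one_le_div ha).2 hab
        have h2 : 36 * R ≤ R * (36 * (b / a) + 4 * ε) + 6 * ε * b := by
          have h3 : 0 < b := ha.trans_le hab
          have h4 : 0 ≤ R * (36 * (b / a - 1) + 4 * ε) :=
            mul_nonneg hR0.le (by linarith)
          have h5 : 0 ≤ 6 * ε * b := by positivity
          linarith
        have h6 := mul_le_mul_of_nonneg_right h2 (show 0 ≤ ε ^ 2 * a by positivity)
        linarith
      have h7 := mul_le_mul_of_nonneg_right h1 (show 0 ≤ ε * a / (2 * R) by positivity)
      refine le_trans ?_ h7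
      rw [show 12 * R / (ε ^ 2 * a) * Real.log x * (ε * a / (2 * R)) = 6 / ε * Real.log x by
        field_simp; norm_num]
      refine le_mul_of_one_le_left hlog.le ?_
      rw [one_le_div hε]
      linarith
    rw [hexp]
    have h8 : Real.exp (-(L * (ε * a / (2 * R)))) ≤ x⁻¹ := by
      rw [← Real.exp_log (inv_pos.2 hx0), Real.log_inv]
      exact Real.exp_le_exp.2 (neg_le_neg hS)
    calc (K : ℝ) * Real.exp (-(L * (ε * a / (2 * R)))) ≤ (N ^ D * M) * x⁻¹ :=
          mul_le_mul hK h8 (Real.exp_pos _).le (by positivity)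
      _ = 1 / p * (M / c₀) := by
          rw [hxdef]
          field_simp

theorem IsTruncatedCoeff.eq_zero_of_no_samples {A : Matrix (Fin 0) (Fin K) ℝ} {Y : Fin 0 → ℝ}
    {τ : ℝ} {α : Fin K → ℝ} (h : IsTruncatedCoeff A Y τ α) : α = 0 := by
  obtain ⟨U, s, V, -, hgood, -⟩ := h
  rw [hgood fun k => by simpa using sq_nonneg (s k)]
  funext k
  simp [mulVec, dotProduct]

theorem card_basisIndex_pos (hN : 0 < N) : 0 < Fintype.card (BasisIndex D N Q) :=
  Fintype.card_pos_iff.2 ⟨(fun _ => ⟨0, hN⟩, ⟨fun _ => 0, by simp⟩)⟩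

/-- The error bound. It is the estimate of `integral_truncated_le` with the law of the sample,
except if there are no samples at all, where the coefficients vanish. -/
theorem risk_le (hD : 0 < D) (hγ : 0 < γ) (hε : 0 < ε) (hε1 : ε < 1) (hc₀ : 0 < c₀)
    (hf : ContinuousOn f (unitCube D)) (hfpos : ∀ x ∈ unitCube D, 0 < f x)
    (hf1 : ∫ x in unitCube D, f x = 1) (hy : IsHolderSmooth Q γ C y)
    (hN : 0 < N) (hL : sampleBound Q N γ ε c₀ f ≤ L)
    {Ω : Type*} [MeasurableSpace Ω] {P : Measure Ω} [IsProbabilityMeasure P]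
    {e : Fin K ≃ BasisIndex D N Q} {X : Fin L → Ω → Fin D → ℝ} {α : Ω → Fin K → ℝ}
    (h : IsRegressionRun P f y ((1 - ε) * lowerBd f / 2) e X α) :
    (∀ ω, IntegrableOn (fun x => |y x - estimate e (α ω) x| ^ 2) (unitCube D) (cubeLaw f)) ∧
    IntegrableOn (fun x => |y x| ^ 2) (unitCube D) (cubeLaw f) ∧
    Integrable (fun ω => sqError f y e (α ω)) P ∧
    ∫ ω, sqError f y e (α ω) ∂P ≤
      1 / (N : ℝ) ^ (2 * (Q + γ)) *
        ((1 + 3 * upperBd f / (lowerBd f * (1 - ε))) *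
            ((D : ℝ) ^ (2 * Q + γ) / (Q.factorial : ℝ) ^ 2) * C ^ 2 +
          2 * ((D + Q).choose D : ℝ) / c₀ *
            ∫ x in unitCube D, |y x| ^ 2 ∂(cubeLaw f)) := by
  have := isProbabilityMeasure_cubeLaw hf hfpos hf1
  have hN' : (0 : ℝ) < N := Nat.cast_pos.2 hN
  have ha := lowerBd_pos hf hfpos
  have hb := ha.trans_le (lowerBd_le_upperBd hf)
  have hyL : MemLp y 2 (cubeLaw f) := memLp_cubeLaw hy.1.continuousOn
  have hη := measurable_basisVec e
  have hR := basisVec_dotProduct_self_le e hN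
  have hKc : K = Fintype.card (BasisIndex D N Q) := by
    rw [← Fintype.card_congr e, Fintype.card_fin]
  have hK : (K : ℝ) ≤ N ^ D * (D + Q).choose D := by
    rw [hKc]
    exact_mod_cast card_basisIndex_le
  have hK1 : (1 : ℝ) ≤ K := by
    rw [hKc]
    exact_mod_cast card_basisIndex_pos hN
  set I := ∫ x, y x ^ 2 ∂cubeLaw f with hI
  have hI0 : 0 ≤ I := integral_nonneg fun x => sq_nonneg _
  have hIr : ∫ x in unitCube D, |y x| ^ 2 ∂(cubeLaw f) = I := by
    rw [cubeLaw_restrict]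
    simp only [sq_abs, hI]
  have htr := truncation_le hf hfpos hε hε1 hc₀ hN hL hK
  have hp := Real.rpow_pos_of_pos hN' (2 * ((Q : ℝ) + γ))
  have hεpos : 0 < 1 - ε := by linarith
  have hA0 : 0 ≤ (1 + 3 * upperBd f / (lowerBd f * (1 - ε))) *
      ((D : ℝ) ^ (2 * (Q : ℝ) + γ) / (Q.factorial : ℝ) ^ 2) * C ^ 2 := by positivity
  have htrI := mul_le_mul_of_nonneg_right htr hI0
  have hfac : 1 / (N : ℝ) ^ (2 * ((Q : ℝ) + γ)) * (((D + Q).choose D : ℝ) / c₀) * I ≤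
      1 / (N : ℝ) ^ (2 * ((Q : ℝ) + γ)) * (2 * ((D + Q).choose D : ℝ) / c₀ * I) := by
    rw [mul_assoc]
    refine mul_le_mul_of_nonneg_left (mul_le_mul_of_nonneg_right ?_ hI0) (by positivity)
    gcongr
    linarith [Nat.cast_nonneg (α := ℝ) ((D + Q).choose D)]
  refine ⟨fun ω => ?_, ?_, ?_⟩
  · rw [IntegrableOn, cubeLaw_restrict]
    simp only [sq_abs, estimate_eq_dotProduct]
    exact (hyL.sub (memLp_dotProduct hη hR (α ω))).integrable_sq
  · rw [IntegrableOn, cubeLaw_restrict]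
    simp only [sq_abs]
    exact hyL.integrable_sq
  simp only [sqError_eq, hIr]
  rcases Nat.eq_zero_or_pos L with hL0 | hL0
  · subst hL0
    have hα : ∀ ω, α ω = 0 := fun ω => (h.coeff ω).eq_zero_of_no_samples
    simp only [hα, zero_dotProduct, sub_zero]
    refine ⟨integrable_const _, ?_⟩
    rw [integral_const, probReal_univ, one_smul]
    simp only [Nat.cast_zero, zero_mul, Real.exp_zero, mul_one, min_eq_left hK1, one_mul] at htrI
    refine (htrI.trans hfac).trans (mul_le_mul_of_nonneg_left ?_ (by positivity))
    linarith
  · have hM : (0 : ℝ) < (D + Q).choose D := Nat.cast_pos.2 (Nat.choose_pos (by omega))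
    obtain ⟨β, hβ⟩ := exists_approx e hγ hy hN f
    have hmain := integral_truncated_le hη (by positivity) hR ha
      (fun v => (integral_sq_dotProduct_bounds e hf hfpos hN v).1)
      (fun v => (integral_sq_dotProduct_bounds e hf hfpos hN v).2) hb.le hyL h.indep h.law
      (by positivity) hL0 h.coeff hβ
    refine ⟨hmain.1, hmain.2.trans ?_⟩
    rw [sq_approx_bound hD hN, mul_add (1 / (N : ℝ) ^ (2 * ((Q : ℝ) + γ)))]
    refine add_le_add ?_ (htrI.trans hfac)
    rw [mul_assoc]
    refine mul_le_mul_of_nonneg_left ?_ (by positivity)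
    rw [mul_comm, ← mul_assoc]
    refine mul_le_mul_of_nonneg_right (mul_le_mul_of_nonneg_right ?_ (by positivity))
      (sq_nonneg _)
    have h1 : upperBd f / ((1 - ε) * lowerBd f / 2) =
        2 * upperBd f / (lowerBd f * (1 - ε)) := by
      field_simp
    rw [h1]
    gcongr
    norm_num

end ErrorBound

end SVDRegression

/-! ### The convergence rate -/

namespace SVDRegression

section Rate

open Filter Topology

/-- The largest grid for a given number of samples: if `S n = (κ n^D + κ') log (c₀ n^p)`, then for
large `L` there is a largest `N` with `S N ≤ L`; it is at least any prescribed number, and `L` is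
at most a constant times `N^D log L`. -/
theorem exists_isGreatest_and_rate {D : ℕ} (hD : 0 < D) {κ κ' c₀ p : ℝ} (hκ : 0 < κ) (hκ' : 0 ≤ κ')
    (hc₀ : 0 < c₀) (hp : 0 < p) (n₀ : ℕ) :
    ∃ c > 0, ∃ L₀ : ℕ, ∀ L : ℕ, L₀ ≤ L → 1 ≤ Real.log L ∧ ∃ N : ℕ,
      IsGreatest {n : ℕ | 0 < n ∧ (κ * (n : ℝ) ^ D + κ') * Real.log (c₀ * (n : ℝ) ^ p) ≤ L} N ∧
        n₀ ≤ N ∧ (L : ℝ) ≤ c * (N : ℝ) ^ D * Real.log L := by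
  set S : ℕ → ℝ := fun n => (κ * (n : ℝ) ^ D + κ') * Real.log (c₀ * (n : ℝ) ^ p) with hS
  have hlog : Tendsto (fun n : ℕ => Real.log (c₀ * (n : ℝ) ^ p)) atTop atTop :=
    Real.tendsto_log_atTop.comp (((tendsto_rpow_atTop hp).comp
      tendsto_natCast_atTop_atTop).const_mul_atTop hc₀)
  obtain ⟨n₁, hn₁⟩ := eventually_atTop.1 (hlog.eventually_ge_atTop 1)
  set n₂ := max n₀ (max n₁ 1) with hn₂
  have hκn : ∀ n : ℕ, 0 < n → κ * n ≤ κ * (n : ℝ) ^ D + κ' := fun n hn => by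
    have h1 : (n : ℝ) ≤ (n : ℝ) ^ D :=
      le_self_pow₀ (Nat.one_le_cast.2 hn) hD.ne'
    nlinarith
  have hStop : Tendsto S atTop atTop := by
    refine tendsto_atTop_mono' _ ?_ (tendsto_natCast_atTop_atTop.const_mul_atTop hκ)
    filter_upwards [eventually_ge_atTop n₁, eventually_gt_atTop 0] with n hn hn0
    have h1 := hκn n hn0
    have h0 : 0 ≤ κ * (n : ℝ) := by positivity
    exact h1.trans (le_mul_of_one_le_right (h0.trans h1) (hn₁ n hn))
  set c₁ : ℝ := |Real.log (c₀ * 2 ^ p) - p * Real.log κ| + p with hc₁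
  have hc₁0 : 0 < c₁ := by positivity
  have hlogL := (Real.tendsto_log_atTop.comp tendsto_natCast_atTop_atTop).eventually_ge_atTop 1
  obtain ⟨L₁, hL₁⟩ := eventually_atTop.1 hlogL
  refine ⟨(κ * 2 ^ D + κ') * c₁, by positivity, max L₁ ⌈S n₂⌉₊, fun L hL => ?_⟩
  have hlL : 1 ≤ Real.log L := hL₁ L ((le_max_left _ _).trans hL)
  refine ⟨hlL, ?_⟩
  have hSn₂ : S n₂ ≤ L :=
    (Nat.le_ceil _).trans (by exact_mod_cast (le_max_right _ _).trans hL)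
  set A : Set ℕ := {n : ℕ | 0 < n ∧ S n ≤ L} with hA
  have hn₂A : n₂ ∈ A := ⟨by omega, hSn₂⟩
  have hbdd : BddAbove A := by
    obtain ⟨m, hm⟩ := eventually_atTop.1 (hStop.eventually_gt_atTop (L : ℝ))
    refine ⟨m, fun n hn => ?_⟩
    by_contra h
    exact absurd hn.2 (not_le.2 (hm n (not_le.1 h).le))
  obtain ⟨N, hN⟩ : ∃ N, IsGreatest A N :=
    ⟨sSup A, Nat.sSup_mem ⟨n₂, hn₂A⟩ hbdd, fun n hn => le_csSup hbdd hn⟩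
  have hNn₂ : n₂ ≤ N := hN.2 hn₂A
  refine ⟨N, hN, by omega, ?_⟩
  have hN0 : 0 < N := hN.1.1
  have hNR : (1 : ℝ) ≤ N := Nat.one_le_cast.2 hN0
  have hL0 : (0 : ℝ) < L := by
    rcases Nat.eq_zero_or_pos L with h | h
    · rw [h] at hlL
      norm_num at hlL
    · exact Nat.cast_pos.2 h
  -- the next grid is too fine, hence `L < S (N + 1)`
  have hlt : (L : ℝ) < S (N + 1) := by
    by_contra h
    have := hN.2 ⟨Nat.succ_pos N, not_lt.1 h⟩
    omega
  have hle2 : ((N + 1 : ℕ) : ℝ) ≤ 2 * N := by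
    push_cast
    linarith
  have hκN : κ * N ≤ L := by
    have h1 := hκn N hN0
    have h0 : 0 ≤ κ * (N : ℝ) := by positivity
    exact (h1.trans (le_mul_of_one_le_right (h0.trans h1) (hn₁ N (by omega)))).trans hN.1.2
  have hlog1 : Real.log (c₀ * ((N + 1 : ℕ) : ℝ) ^ p) ≤ c₁ * Real.log L := by
    have h1 : c₀ * ((N + 1 : ℕ) : ℝ) ^ p ≤ c₀ * 2 ^ p * (N : ℝ) ^ p := by
      rw [mul_assoc, ← Real.mul_rpow (by norm_num) (by positivity)]
      exact mul_le_mul_of_nonneg_left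
        (Real.rpow_le_rpow (by positivity) hle2 hp.le) hc₀.le
    have hNp : 0 < (N : ℝ) ^ p := Real.rpow_pos_of_pos (by linarith) _
    have h2p : (0 : ℝ) < 2 ^ p := Real.rpow_pos_of_pos (by norm_num) _
    have h2 := Real.log_le_log (by positivity) h1
    rw [Real.log_mul (by positivity) hNp.ne', Real.log_rpow (by linarith)] at h2
    have h3 : Real.log N ≤ Real.log L - Real.log κ := by
      rw [← Real.log_div hL0.ne' hκ.ne']
      refine Real.log_le_log (by linarith) ?_
      rw [le_div_iff₀ hκ]
      linarith
    have h4 : Real.log (c₀ * 2 ^ p) - p * Real.log κ ≤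
        |Real.log (c₀ * 2 ^ p) - p * Real.log κ| * Real.log L :=
      (le_abs_self _).trans (le_mul_of_one_le_right (abs_nonneg _) hlL)
    have h5 := mul_le_mul_of_nonneg_left h3 hp.le
    rw [hc₁, add_mul]
    linarith
  have hcoef : κ * ((N + 1 : ℕ) : ℝ) ^ D + κ' ≤ (κ * 2 ^ D + κ') * (N : ℝ) ^ D := by
    have h1 : ((N + 1 : ℕ) : ℝ) ^ D ≤ 2 ^ D * (N : ℝ) ^ D := by
      rw [← mul_pow]
      exact pow_le_pow_left₀ (by positivity) hle2 D
    have h2 : κ' ≤ κ' * (N : ℝ) ^ D := le_mul_of_one_le_right hκ' (one_le_pow₀ hNR)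
    have h3 := mul_le_mul_of_nonneg_left h1 hκ.le
    linarith
  have hlog0 : 0 ≤ Real.log (c₀ * ((N + 1 : ℕ) : ℝ) ^ p) :=
    zero_le_one.trans (hn₁ (N + 1) (by omega))
  refine hlt.le.trans ((mul_le_mul hcoef hlog1 hlog0 (by positivity)).trans_eq ?_)
  ring

variable {D : ℕ} {f : (Fin D → ℝ) → ℝ}

theorem exists_modulus_le (hf : ContinuousOn f (unitCube D)) {η : ℝ} (hη : 0 < η) :
    ∃ n₀ : ℕ, ∀ n : ℕ, n₀ ≤ n → modulus f (1 / n) ≤ η := by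
  have hu := (isCompact_unitCube D).uniformContinuousOn_of_continuous hf
  obtain ⟨δ, hδ, h⟩ := Metric.uniformContinuousOn_iff.1 hu η hη
  obtain ⟨n₀, hn₀⟩ := exists_nat_one_div_lt hδ
  refine ⟨n₀ + 1, fun n hn => Real.sSup_le ?_ hη.le⟩
  rintro r ⟨x, hx, z, hz, hxz, rfl⟩
  have h1 : (1 : ℝ) / n ≤ 1 / ((n₀ : ℝ) + 1) :=
    one_div_le_one_div_of_le (by positivity) (by exact_mod_cast hn)
  have h2 := h x hx z hz (by rw [dist_eq_norm]; linarith)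
  rw [Real.dist_eq] at h2
  exact h2.le

theorem exists_gridCondition (Q : ℕ) (hf : ContinuousOn f (unitCube D))
    (hfpos : ∀ x ∈ unitCube D, 0 < f x) :
    ∃ n₀ : ℕ, ∀ n : ℕ, n₀ ≤ n → GridCondition Q n f := by
  have ha := lowerBd_pos hf hfpos
  have hM : (0 : ℝ) < (D + Q).choose D := Nat.cast_pos.2 (Nat.choose_pos (by omega))
  have hc : 0 < 2 * ((D + Q).choose D : ℝ) * Real.exp (2 * Q) := by positivity
  obtain ⟨n₀, h⟩ := exists_modulus_le hf (div_pos ha hc)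
  exact ⟨n₀, fun n hn => Or.inr (by
    have := (le_div_iff₀ hc).1 (h n hn)
    linarith)⟩

theorem sampleBound_eq (Q N : ℕ) (γ ε c₀ : ℝ) (f : (Fin D → ℝ) → ℝ) :
    sampleBound Q N γ ε c₀ f =
      ((D + Q).choose D * Real.exp (2 * Q) * (36 * (upperBd f / lowerBd f) + 4 * ε) /
          (3 * ε ^ 2 * lowerBd f) * (N : ℝ) ^ D + 6 * ε * upperBd f / (3 * ε ^ 2 * lowerBd f)) *
        Real.log (c₀ * (N : ℝ) ^ ((D : ℝ) + 2 * (Q + γ))) := by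
  rw [sampleBound]
  ring

/-- A squared error of order `N^{-2s}` is of order `(log L / L)^{s/D}`, if `L` is at most of order
`N^D log L`. -/
theorem sqrt_le_rate {D N L : ℕ} (hD : 0 < D) {s c G E : ℝ} (hs : 0 < s) (hc : 0 < c) (hG : 0 ≤ G)
    (hN : 0 < N) (hlog : 1 ≤ Real.log L) (hL : (L : ℝ) ≤ c * (N : ℝ) ^ D * Real.log L)
    (hE : E ≤ 1 / (N : ℝ) ^ (2 * s) * G) :
    √E ≤ √G * c ^ (s / D) * (L : ℝ) ^ (-(s / D)) * Real.log L ^ (s / D) := by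
  have hN' : (0 : ℝ) < N := Nat.cast_pos.2 hN
  have hD' : (0 : ℝ) < D := Nat.cast_pos.2 hD
  have hL0 : (0 : ℝ) < L := by
    rcases Nat.eq_zero_or_pos L with h | h
    · rw [h] at hlog
      norm_num at hlog
    · exact Nat.cast_pos.2 h
  have hNs : 0 < (N : ℝ) ^ s := Real.rpow_pos_of_pos hN' _
  have h1 : √E ≤ √G * ((N : ℝ) ^ s)⁻¹ := by
    refine (Real.sqrt_le_sqrt hE).trans_eq ?_
    rw [mul_comm 2 s, Real.rpow_mul hN'.le, mul_comm, Real.sqrt_mul hG, one_div, Real.sqrt_inv,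
      show (2 : ℝ) = ((2 : ℕ) : ℝ) by norm_num, Real.rpow_natCast, Real.sqrt_sq hNs.le]
  have hlog0 : 0 < Real.log L := by linarith
  have h2 : ((N : ℝ) ^ s)⁻¹ ≤ c ^ (s / D) * (L : ℝ) ^ (-(s / D)) * Real.log L ^ (s / D) := by
    have h3 : ((N : ℝ) ^ D) ^ (s / D) = (N : ℝ) ^ s := by
      rw [← Real.rpow_natCast, ← Real.rpow_mul hN'.le, mul_div_cancel₀ _ hD'.ne']
    have h4 := Real.rpow_le_rpow hL0.le hL (div_pos hs hD').le
    rw [Real.mul_rpow (by positivity) hlog0.le, Real.mul_rpow hc.le (by positivity), h3] at h4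
    have h5 := Real.rpow_pos_of_pos hL0 (s / D)
    rw [Real.rpow_neg hL0.le, inv_eq_one_div, div_le_iff₀ hNs]
    have h6 : c ^ (s / D) * ((L : ℝ) ^ (s / D))⁻¹ * Real.log L ^ (s / D) * (N : ℝ) ^ s =
        (c ^ (s / D) * (N : ℝ) ^ s * Real.log L ^ (s / D)) / (L : ℝ) ^ (s / D) := by
      field_simp
    rw [h6, one_le_div h5]
    exact h4
  refine h1.trans ((mul_le_mul_of_nonneg_left h2 (Real.sqrt_nonneg _)).trans_eq ?_)
  ring

end Rate

end SVDRegression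

theorem theorem4p4 {D Q : ℕ} (hD : 0 < D) {γ C ε c₀ : ℝ}
    (hγ : 0 < γ) (hγ1 : γ ≤ 1) (hε : 0 < ε) (hε1 : ε < 1) (hc₀ : 0 < c₀)
    {f y : (Fin D → ℝ) → ℝ}
    (hf : ContinuousOn f (unitCube D)) (hfpos : ∀ x ∈ unitCube D, 0 < f x)
    (hf1 : ∫ x in unitCube D, f x = 1)
    (hy : IsHolderSmooth Q γ C y) :
    -- the error bound
    (∀ N L : ℕ, 0 < N → GridCondition Q N f → sampleBound Q N γ ε c₀ f ≤ L →
      ∀ (Ω : Type u) [MeasurableSpace Ω] (P : Measure Ω) [IsProbabilityMeasure P] (K : ℕ)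
        (e : Fin K ≃ BasisIndex D N Q) (X : Fin L → Ω → Fin D → ℝ) (α : Ω → Fin K → ℝ),
        IsRegressionRun P f y ((1 - ε) * lowerBd f / 2) e X α →
        (∀ ω, IntegrableOn (fun x => |y x - estimate e (α ω) x| ^ 2) (unitCube D) (cubeLaw f)) ∧
        IntegrableOn (fun x => |y x| ^ 2) (unitCube D) (cubeLaw f) ∧
        Integrable (fun ω => sqError f y e (α ω)) P ∧
        ∫ ω, sqError f y e (α ω) ∂P ≤
          1 / (N : ℝ) ^ (2 * (Q + γ)) *
            ((1 + 3 * upperBd f / (lowerBd f * (1 - ε))) *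
                ((D : ℝ) ^ (2 * Q + γ) / (Q.factorial : ℝ) ^ 2) * C ^ 2 +
              2 * ((D + Q).choose D : ℝ) / c₀ *
                ∫ x in unitCube D, |y x| ^ 2 ∂(cubeLaw f))) ∧
    -- the resulting rate, when `N` is the largest integer compatible with `L` samples
    (∃ c : ℝ, ∃ L₀ : ℕ, ∀ L : ℕ, L₀ ≤ L →
      ∃ N : ℕ, IsGreatest {n : ℕ | 0 < n ∧ sampleBound Q n γ ε c₀ f ≤ L} N ∧
        GridCondition Q N f ∧
        ∀ (Ω : Type u) [MeasurableSpace Ω] (P : Measure Ω) [IsProbabilityMeasure P] (K : ℕ)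
          (e : Fin K ≃ BasisIndex D N Q) (X : Fin L → Ω → Fin D → ℝ) (α : Ω → Fin K → ℝ),
          IsRegressionRun P f y ((1 - ε) * lowerBd f / 2) e X α →
          √(∫ ω, sqError f y e (α ω) ∂P) ≤
            c * (L : ℝ) ^ (-((Q + γ) / D)) * Real.log L ^ ((Q + γ) / D)) := by
  refine ⟨fun N L hN _ hL Ω _ P _ K e X α h =>
    risk_le hD hγ hε hε1 hc₀ hf hfpos hf1 hy hN hL h, ?_⟩
  have ha := lowerBd_pos hf hfpos
  have hb := ha.trans_le (lowerBd_le_upperBd hf)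
  have hM : (0 : ℝ) < (D + Q).choose D := Nat.cast_pos.2 (Nat.choose_pos (by omega))
  have hεpos : 0 < 1 - ε := by linarith
  obtain ⟨n₀, hn₀⟩ := exists_gridCondition Q hf hfpos
  obtain ⟨c, hc, L₀, hrate⟩ := exists_isGreatest_and_rate hD
    (κ := (D + Q).choose D * Real.exp (2 * Q) * (36 * (upperBd f / lowerBd f) + 4 * ε) /
      (3 * ε ^ 2 * lowerBd f)) (κ' := 6 * ε * upperBd f / (3 * ε ^ 2 * lowerBd f))
    (p := (D : ℝ) + 2 * (Q + γ)) (by positivity) (by positivity) hc₀ (by positivity) n₀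
  refine ⟨√((1 + 3 * upperBd f / (lowerBd f * (1 - ε))) *
      ((D : ℝ) ^ (2 * Q + γ) / (Q.factorial : ℝ) ^ 2) * C ^ 2 +
        2 * ((D + Q).choose D : ℝ) / c₀ * ∫ x in unitCube D, |y x| ^ 2 ∂(cubeLaw f)) *
      c ^ ((Q + γ) / D), L₀, fun L hL => ?_⟩
  obtain ⟨hlog, N, hN, hNn₀, hLN⟩ := hrate L hL
  simp only [← sampleBound_eq] at hN
  refine ⟨N, hN, hn₀ N hNn₀, fun Ω _ P _ K e X α h => ?_⟩
  have hI : 0 ≤ ∫ x in unitCube D, |y x| ^ 2 ∂(cubeLaw f) :=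
    integral_nonneg fun x => sq_nonneg _
  exact sqrt_le_rate hD (by positivity) hc (by positivity) hN.1.1 hlog hLN
    (risk_le hD hγ hε hε1 hc₀ hf hfpos hf1 hy hN.1.1 hN.1.2 h).2.2.2
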